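/- Let $n\ge 2$. A game $X$ consists of $n$ payoff tables $X^{(1)},\dots,X^{(n)}$, where $X^{(i)}=(X^{(i)}_{j_1\cdots j_n})_{j_1,\dots,j_n\in\{1,2\}}$ has real entries. Let $\mathcal M=(\mathbb P^1)^{n-2}\times\mathbb P^3$ over $\mathbb C$, with the Zariski topology and homogeneous coordinates $\sigma^{(i)}_1,\sigma^{(i)}_2$ on the $i$-th factor $\mathbb P^1$ ($1\le i\le n-2$) and $\tau_{1,1},\tau_{1,2},\tau_{2,1},\tau_{2,2}$ on $\mathbb P^3$. For $i\le n-2$ put $$F_i=\sum_{j_1,\dots,\widehat{j_i},\dots,j_n}\bigl(X^{(i)}_{j_1\cdots 2\cdots j_n}-X^{(i)}_{j_1\cdots 1\cdots j_n}\bigr)\,\sigma^{(1)}_{j_1}\cdots\widehat{\sigma^{(i)}_{j_i}}\cdots\sigma^{(n-2)}_{j_{n-2}}\,\tau_{j_{n-1},j_n},$$ where the indices $2$ and $1$ stand in position $i$, and put $$F_{n-1}=\det\begin{pmatrix}\tau_{1,1}+\tau_{1,2}&\sum_{j_1,\dots,j_{n-2},j_n}X^{(n-1)}_{j_1\cdots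 j_{n-2}1j_n}\sigma^{(1)}_{j_1}\cdots\sigma^{(n-2)}_{j_{n-2}}\tau_{1,j_n}\\ \tau_{2,1}+\tau_{2,2}&\sum_{j_1,\dots,j_{n-2},j_n}X^{(n-1)}_{j_1\cdots j_{n-2}2j_n}\sigma^{(1)}_{j_1}\cdots\sigma^{(n-2)}_{j_{n-2}}\tau_{2,j_n}\end{pmatrix},$$ $$F_{n}=\det\begin{pmatrix}\tau_{1,1}+\tau_{2,1}&\sum_{j_1,\dots,j_{n-1}}X^{(n)}_{j_1\cdots j_{n-1}1}\sigma^{(1)}_{j_1}\cdots\sigma^{(n-2)}_{j_{n-2}}\tau_{j_{n-1},1}\\ \tau_{1,2}+\tau_{2,2}&\sum_{j_1,\dots,j_{n-1}}X^{(n)}_{j_1\cdots j_{n-1}2}\sigma^{(1)}_{j_1}\cdots\sigma^{(n-2)}_{j_{n-2}}\tau_{j_{n-1},2}\end{pmatrix}.$$ Let $C_X=\mathbb V(F_1,\dots,F_n)\subseteq\mathcal M$ be the Spohn conditional independence variety of $X$ for the one-edge undirected graphical model. Then for a generic game $X$, that is, for all $X$ outside the zero set of some nonzero real polynomial in the $n2^n$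 payoff entries, the following hold. 1. $C_X$ is a curve: $\dim C_X=1$, and every irreducible component of $C_X$ has dimension $1$. 2. $C_X$ is a complete intersection of $n$ divisors of $\mathcal M$: each $F_i$ is nonzero and multi-homogeneous, of multi-degree $(1,\dots,1,\underset{(i)}{0},1,\dots,1)$ for $i\le n-2$ and of multi-degree $(1,\dots,1,2)$ for $i=n-1,n$ (the last entry is the degree in the $\tau_{a,b}$); $C_X$ is the intersection of the $n$ divisors $\mathbb V(F_1),\dots,\mathbb V(F_n)$; and $C_X$ is nonempty and each of its irreducible components has codimension $n$ in $\mathcal M$. -/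

import Mathlib

noncomputable section

namespace NashCI

open MvPolynomial

/-! ### Games with binary choices

A game has `n = m + 2` players.  The players `1, …, n - 2` are `Sum.inl i` with `i : Fin m`; the
players `n - 1` and `n`, the endpoints of the only edge of the graphical model, are `Sum.inr 0` and
`Sum.inr 1`.  The two strategies `1, 2` of every player are `0, 1 : Fin 2`. -/

/-- The `n = m + 2` players. -/
abbrev Player (m : ℕ) : Type := Fin m ⊕ Fin 2

/-- A tuple `(j₁, …, jₙ)` of pure strategies. -/
abbrev Profile (m : ℕ) : Type := Player m → Fin 2

/-- A game `X`: a payoff table `X⁽ⁱ⁾` of format `2 × ⋯ × 2` with real entries for every player. -/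
abbrev Game (m : ℕ) : Type := Player m → Profile m → ℝ

/-- A property holds for generic games: it holds on the complement of the zero set of some nonzero
polynomial in the payoff entries. -/
def Generic {m : ℕ} (P : Game m → Prop) : Prop :=
  ∃ G : MvPolynomial (Player m × Profile m) ℝ, G ≠ 0 ∧
    ∀ X : Game m, eval (fun e => X e.1 e.2) G ≠ 0 → P X

/-! ### The Segre variety `(ℙ¹)ⁿ⁻² × ℙ³` over `ℂ` -/

/-- The homogeneous coordinates: `Sum.inl (i, j)` stands for `σ⁽ⁱ⁾_j` and `Sum.inr (a, b)` for
`τ_{a,b}`. -/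
abbrev Coord (m : ℕ) : Type := (Fin m × Fin 2) ⊕ (Fin 2 × Fin 2)

/-- The ring `ℂ[σ⁽¹⁾₁, …, τ₂₂]`. -/
abbrev CoordRing (m : ℕ) : Type := MvPolynomial (Coord m) ℂ

/-- The closed points of `(ℙ¹)^m × ℙ³`. -/
structure Segre (m : ℕ) : Type where
  /-- The components in the factors `ℙ¹`. -/
  line : Fin m → Projectivization ℂ (Fin 2 → ℂ)
  /-- The component in the factor `ℙ³`. -/
  space : Projectivization ℂ (Fin 2 × Fin 2 → ℂ)

/-- Homogeneous coordinates of a point. -/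
def Segre.coord {m : ℕ} (p : Segre m) : Coord m → ℂ :=
  Sum.elim (fun e => (p.line e.1).rep e.2) p.space.rep

/-- The factor of the product to which a coordinate belongs; `none` is the factor `ℙ³`. -/
def factor {m : ℕ} : Coord m → Option (Fin m) :=
  Sum.elim (fun e => some e.1) (fun _ => none)

/-- `F` is multi-homogeneous of multi-degree `d`: it has degree `d (some i)` in
`σ⁽ⁱ⁾₁, σ⁽ⁱ⁾₂` and degree `d none` in the `τ_{a,b}`. -/
def IsMultihomogeneous {m : ℕ} (F : CoordRing m) (d : Option (Fin m) → ℕ) : Prop :=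
  IsWeightedHomogeneous (fun v : Coord m => (Pi.single (factor v) 1 : Option (Fin m) → ℕ)) F d

/-- The zero locus `𝕍(F)` of a multi-homogeneous polynomial; for those, vanishing does not depend
on the choice of the homogeneous coordinates. -/
def zeroLocus {m : ℕ} (F : CoordRing m) : Set (Segre m) :=
  {p | eval p.coord F = 0}

/-- The Zariski topology: the zero loci of multi-homogeneous polynomials generate the closed
sets. -/
instance (m : ℕ) : TopologicalSpace (Segre m) :=
  TopologicalSpace.generateFrom
    {U | ∃ (F : CoordRing m) (d : Option (Fin m) → ℕ), IsMultihomogeneous F d ∧ U = (zeroLocus F)ᶜ}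

/-- `Z` is an irreducible component of the closed subset `C`. -/
def IsComponent {m : ℕ} (C : Set (Segre m)) (Z : TopologicalSpace.IrreducibleCloseds (Segre m)) :
    Prop :=
  Maximal (fun W : TopologicalSpace.IrreducibleCloseds (Segre m) => (W : Set (Segre m)) ⊆ C) Z

/-- `C` is the complete intersection of the divisors `𝕍(F i)` of multi-degrees `d i`: it is their
intersection, it is not empty, and all its irreducible components have codimension equal to the
number of the divisors, i.e. the subscheme of `(ℙ¹)^m × ℙ³` cut out by the `F i` has that codimension
everywhere.  The codimension of `Z` is the supremum of the lengths of the chains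
`Z = Z₀ ⊂ Z₁ ⊂ ⋯` of irreducible closed subsets. -/
structure IsCompleteIntersection {m : ℕ} {ι : Type} [Fintype ι] (C : Set (Segre m))
    (F : ι → CoordRing m) (d : ι → Option (Fin m) → ℕ) : Prop where
  ne_zero : ∀ i, F i ≠ 0
  multihomogeneous : ∀ i, IsMultihomogeneous (F i) (d i)
  eq_inter : C = ⋂ i, zeroLocus (F i)
  nonempty : C.Nonempty
  codim_eq : ∀ Z, IsComponent C Z → Order.coheight Z = Fintype.card ι

/-- `C` is a curve: it has dimension one, and so has each of its irreducible components. -/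
structure IsCurve {m : ℕ} (C : Set (Segre m)) : Prop where
  dim_eq_one : topologicalKrullDim C = 1
  pure : ∀ Z, IsComponent C Z → topologicalKrullDim (Z : Set (Segre m)) = 1

/-! ### The polynomials `F₁, …, Fₙ` and the Spohn CI variety -/

/-- The variable `σ⁽ⁱ⁾_j`. -/
def sigma {m : ℕ} (i : Fin m) (j : Fin 2) : CoordRing m := X (Sum.inl (i, j))

/-- The variable `τ_{a,b}`. -/
def tau {m : ℕ} (a b : Fin 2) : CoordRing m := X (Sum.inr (a, b))

/-- For `i ≤ n - 2`, the polynomial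
`Fᵢ = ∑ (X⁽ⁱ⁾_{j₁⋯2⋯jₙ} - X⁽ⁱ⁾_{j₁⋯1⋯jₙ}) σ⁽¹⁾_{j₁} ⋯ (omit σ⁽ⁱ⁾) ⋯ σ⁽ⁿ⁻²⁾_{jₙ₋₂} τ_{jₙ₋₁,jₙ}`,
summed over all `jₖ` with `k ≠ i`.  Such tuples are written as the profiles `j` in which player `i`
uses the first strategy. -/
def lonePoly {m : ℕ} (X : Game m) (i : Fin m) : CoordRing m :=
  ∑ j : Profile m with j (.inl i) = 0,
    C ((X (.inl i) (Function.update j (.inl i) 1) - X (.inl i) j : ℝ) : ℂ) *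
      (∏ k ∈ Finset.univ.erase i, sigma k (j (.inl k))) * tau (j (.inr 0)) (j (.inr 1))

/-- For the player `Sum.inr l` (player `n - 1` or `n`) and a strategy `a` of this player,
`∑ X_{j₁⋯jₙ} σ⁽¹⁾_{j₁} ⋯ σ⁽ⁿ⁻²⁾_{jₙ₋₂} τ_{jₙ₋₁,jₙ}` over all profiles in which the player uses
`a`. -/
def payoffPoly {m : ℕ} (X : Game m) (l : Fin 2) (a : Fin 2) : CoordRing m :=
  ∑ j : Profile m with j (.inr l) = a,
    C ((X (.inr l) j : ℝ) : ℂ) *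
      (∏ k : Fin m, sigma k (j (.inl k))) * tau (j (.inr 0)) (j (.inr 1))

/-- The polynomials `F₁, …, Fₙ` of the game `X`. -/
def poly {m : ℕ} (X : Game m) : Player m → CoordRing m
  | .inl i => lonePoly X i
  | .inr 0 => Matrix.det
      !![tau 0 0 + tau 0 1, payoffPoly X 0 0;
         tau 1 0 + tau 1 1, payoffPoly X 0 1]
  | .inr 1 => Matrix.det
      !![tau 0 0 + tau 1 0, payoffPoly X 1 0;
         tau 0 1 + tau 1 1, payoffPoly X 1 1]

/-- The multi-degrees: `(1, …, 1, 0, 1, …, 1)` with `0` in position `i` for player `i ≤ n - 2`, and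
`(1, …, 1, 2)` for the players `n - 1` and `n`. -/
def multidegree {m : ℕ} : Player m → Option (Fin m) → ℕ
  | .inl i, some k => if k = i then 0 else 1
  | .inl _, none => 1
  | .inr _, some _ => 1
  | .inr _, none => 2

/-- The Spohn CI variety `C_X = 𝕍(F₁, …, Fₙ)` in `(ℙ¹)ⁿ⁻² × ℙ³`. -/
def spohnCI {m : ℕ} (X : Game m) : Set (Segre m) := {p | ∀ i, p ∈ zeroLocus (poly X i)}

end NashCI

end

/-! The ambient variety has dimension `m + 3 = n + 1`, so by Krull's height theorem the components
of an intersection of `n` divisors have codimension at most `n`. The content is the opposite bound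
for generic `X`. It follows once two forms `H₁`, `H₂` of multi-degree `(1, …, 1)` have no common
zero on `C_X`.

If a closed set `Z` misses `𝕍(H₁, H₂)`, then by the multigraded Nullstellensatz `H₁` and `H₂`
generate all forms of large degree `N • δ` modulo those that vanish on `Z`. Hence the Hilbert
function of `Z` along the multiples of `δ` grows at most linearly. Two algebraically independent
functions on an affine chart of an irreducible `Z` would force quadratic growth, so the function
field has transcendence degree at most one. The inequality `card_le_height_add` turns this into
codimension at least `m + 2` (`le_coheight_of_inter_eq_empty`). Irreducible closed sets meeting a
chart correspond to primes of a polynomial ring, which transfers heights and Krull's theorem to the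
product. The same bound gives nonemptiness: if the next divisor missed an intersection of fewer than
`n` divisors, a component of that intersection would have codimension both at most `n - 1` and at
least `n`.

For fixed `H₁`, `H₂`, disjointness is an open condition on `X`: it is implied by the nonvanishing of
a determinant that is polynomial in the payoffs (`generic_of_exists`). So one game suffices. In
`splitGame` each `Fᵢ`, like each `Hᵢ`, is a product of linear forms on factors `ℙ¹` and one linear
or quadratic form on `ℙ³`. The linear forms on a given `ℙ¹` have distinct roots, so at any point the
`m` lines account for the vanishing of at most `m` of the `m + 4` products. At least four of the
forms on `ℙ³` would then vanish at a common point, and they are chosen so that this is impossible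
(`eq_zero_of_cubicValue`). -/

namespace NashCI

open MvPolynomial

/-! ### Homogeneous coordinates -/

/-- The coordinate vectors that represent points of `(ℙ¹)^m × ℙ³`. -/
def Relevant {m : ℕ} (x : Coord m → ℂ) : Prop :=
  ∀ k : Option (Fin m), ∃ c, factor c = k ∧ x c ≠ 0

/-- The point with given homogeneous coordinates. -/
noncomputable def ofCoord {m : ℕ} (x : Coord m → ℂ) (hx : Relevant x) : Segre m where
  line i := Projectivization.mk ℂ (fun j => x (.inl (i, j))) <| by
    obtain ⟨c, hc, hne⟩ := hx (some i)
    rcases c with ⟨i', j⟩ | c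
    · obtain rfl : i' = i := by simpa [factor] using hc
      exact fun h => hne (congrFun h j)
    · simp [factor] at hc
  space := Projectivization.mk ℂ (fun c => x (.inr c)) <| by
    obtain ⟨c, hc, hne⟩ := hx none
    rcases c with c | c
    · simp [factor] at hc
    · exact fun h => hne (congrFun h c)

lemma Segre.relevant_coord {m : ℕ} (p : Segre m) : Relevant p.coord := by
  rintro (_ | i)
  · obtain ⟨c, hc⟩ := Function.ne_iff.1 p.space.rep_nonzero
    exact ⟨.inr c, rfl, hc⟩
  · obtain ⟨j, hj⟩ := Function.ne_iff.1 (p.line i).rep_nonzero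
    exact ⟨.inl (i, j), rfl, hj⟩

lemma exists_coord_ofCoord {m : ℕ} (x : Coord m → ℂ) (hx : Relevant x) :
    ∃ l : Option (Fin m) → ℂ, (∀ k, l k ≠ 0) ∧
      (ofCoord x hx).coord = fun c => l (factor c) * x c := by
  have h1 (i : Fin m) := Projectivization.exists_smul_eq_mk_rep ℂ (fun j => x (.inl (i, j)))
    (by
      obtain ⟨c, hc, hne⟩ := hx (some i)
      rcases c with ⟨i', j⟩ | c
      · obtain rfl : i' = i := by simpa [factor] using hc
        exact fun h => hne (congrFun h j)
      · simp [factor] at hc)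
  choose a ha using h1
  obtain ⟨b, hb⟩ := Projectivization.exists_smul_eq_mk_rep ℂ (fun c => x (.inr c))
    (by
      obtain ⟨c, hc, hne⟩ := hx none
      rcases c with c | c
      · simp [factor] at hc
      · exact fun h => hne (congrFun h c))
  refine ⟨fun k => k.elim b (fun i => a i), ?_, ?_⟩
  · rintro (_ | i)
    · exact b.ne_zero
    · exact (a i).ne_zero
  · funext c
    rcases c with ⟨i, j⟩ | c
    · exact (congrFun (ha i) j).symm
    · exact (congrFun hb c).symm

lemma ofCoord_eq_ofCoord {m : ℕ} {x y : Coord m → ℂ} (hx : Relevant x) (hy : Relevant y)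
    (l : Option (Fin m) → ℂ) (h : ∀ c, y c = l (factor c) * x c) : ofCoord x hx = ofCoord y hy := by
  unfold ofCoord
  congr 1
  · funext i
    exact ((Projectivization.mk_eq_mk_iff' ..).2 ⟨l (some i), by funext j; simp [h, factor]⟩).symm
  · exact ((Projectivization.mk_eq_mk_iff' ..).2 ⟨l none, by funext j; simp [h, factor]⟩).symm

lemma ofCoord_coord {m : ℕ} (p : Segre m) : ofCoord p.coord p.relevant_coord = p := by
  cases p
  simp only [ofCoord, Segre.coord, Sum.elim_inl, Sum.elim_inr]
  congr 1
  · funext i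
    exact Projectivization.mk_rep _
  · exact Projectivization.mk_rep _

lemma eval_scale {m : ℕ} {F : CoordRing m} {d : Option (Fin m) → ℕ} (hF : IsMultihomogeneous F d)
    (l : Option (Fin m) → ℂ) (x : Coord m → ℂ) :
    eval (fun c => l (factor c) * x c) F = (∏ k, l k ^ d k) * eval x F := by
  rw [eval_eq, eval_eq, Finset.mul_sum]
  refine Finset.sum_congr rfl fun μ hμ => ?_
  have hd := hF (mem_support_iff.1 hμ)
  have : ∏ k, l k ^ d k = ∏ c ∈ μ.support, l (factor c) ^ μ c := by
    have h2 (k : Option (Fin m)) :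
        d k = ∑ c ∈ μ.support, if factor c = k then μ c else 0 := by
      rw [← hd, Finsupp.weight_apply, Finsupp.sum, Finset.sum_apply]
      refine Finset.sum_congr rfl fun c _ => ?_
      by_cases h : factor c = k
      · subst h; simp
      · simp [h, Ne.symm h]
    simp_rw [h2, ← Finset.prod_pow_eq_pow_sum]
    rw [Finset.prod_comm]
    refine Finset.prod_congr rfl fun c _ => ?_
    rw [Finset.prod_eq_single (factor c)] <;> simp +contextual [eq_comm]
  rw [this]
  simp only [mul_pow, Finset.prod_mul_distrib]
  ring

lemma ofCoord_mem_zeroLocus {m : ℕ} {F : CoordRing m} {d : Option (Fin m) → ℕ}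
    (hF : IsMultihomogeneous F d) (x : Coord m → ℂ) (hx : Relevant x) :
    ofCoord x hx ∈ zeroLocus F ↔ eval x F = 0 := by
  obtain ⟨l, hl, h⟩ := exists_coord_ofCoord x hx
  change eval _ F = 0 ↔ _
  rw [h, eval_scale hF, mul_eq_zero, or_iff_right]
  exact Finset.prod_ne_zero_iff.2 fun k _ => pow_ne_zero _ (hl k)

lemma zeroLocus_mul {m : ℕ} (F G : CoordRing m) :
    zeroLocus (F * G) = zeroLocus F ∪ zeroLocus G := by
  ext p
  simp [zeroLocus]

/-! ### The Zariski topology -/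

lemma isClosed_zeroLocus {m : ℕ} {F : CoordRing m} {d : Option (Fin m) → ℕ}
    (hF : IsMultihomogeneous F d) : IsClosed (zeroLocus F) :=
  ⟨TopologicalSpace.isOpen_generateFrom_of_mem ⟨F, d, hF, rfl⟩⟩

/-- Products of forms show that complements of zero loci are stable under finite intersections, so
the generating family of the topology is in fact a basis. -/
lemma exists_subset_of_isOpen {m : ℕ} {U : Set (Segre m)} (hU : IsOpen U) {p : Segre m}
    (hp : p ∈ U) : ∃ (F : CoordRing m) (d : Option (Fin m) → ℕ),
      IsMultihomogeneous F d ∧ p ∉ zeroLocus F ∧ (zeroLocus F)ᶜ ⊆ U := by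
  induction hU with
  | basic s hs =>
    obtain ⟨F, d, hF, rfl⟩ := hs
    exact ⟨F, d, hF, hp, subset_rfl⟩
  | univ =>
    exact ⟨1, 0, isWeightedHomogeneous_one _ _, by simp [zeroLocus], Set.subset_univ _⟩
  | inter s t _ _ hs ht =>
    obtain ⟨F, d, hF, hpF, hFs⟩ := hs hp.1
    obtain ⟨G, e, hG, hpG, hGt⟩ := ht hp.2
    refine ⟨F * G, d + e, hF.mul hG, ?_, ?_⟩
    · simp [zeroLocus_mul, hpF, hpG]
    · rw [zeroLocus_mul, Set.compl_union]
      exact Set.inter_subset_inter hFs hGt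
  | sUnion S _ hS =>
    obtain ⟨s, hs, hps⟩ := hp
    obtain ⟨F, d, hF, hpF, hFs⟩ := hS s hs hps
    exact ⟨F, d, hF, hpF, hFs.trans (Set.subset_sUnion_of_mem hs)⟩

/-- A closed set is cut out by the multi-homogeneous polynomials that vanish on it. -/
lemma mem_of_forall_zeroLocus {m : ℕ} {Z : Set (Segre m)} (hZ : IsClosed Z) {p : Segre m}
    (h : ∀ (F : CoordRing m) (d : Option (Fin m) → ℕ), IsMultihomogeneous F d →
      Z ⊆ zeroLocus F → p ∈ zeroLocus F) : p ∈ Z := by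
  by_contra hp
  obtain ⟨F, d, hF, hpF, hFZ⟩ := exists_subset_of_isOpen hZ.isOpen_compl hp
  exact hpF (h F d hF (Set.compl_subset_compl.1 hFZ))

lemma subset_or_subset_of_mul {m : ℕ} {Z : Set (Segre m)} (hZ : IsIrreducible Z)
    {F G : CoordRing m} {d e : Option (Fin m) → ℕ} (hF : IsMultihomogeneous F d)
    (hG : IsMultihomogeneous G e) (h : Z ⊆ zeroLocus (F * G)) :
    Z ⊆ zeroLocus F ∨ Z ⊆ zeroLocus G :=
  isPreirreducible_iff_isClosed_union_isClosed.1 hZ.isPreirreducible _ _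
    (isClosed_zeroLocus hF) (isClosed_zeroLocus hG) (zeroLocus_mul F G ▸ h)

lemma isIrreducible_of_mul {m : ℕ} {Z : Set (Segre m)} (hne : Z.Nonempty)
    (h : ∀ (F G : CoordRing m) (d e : Option (Fin m) → ℕ), IsMultihomogeneous F d →
      IsMultihomogeneous G e → Z ⊆ zeroLocus (F * G) → Z ⊆ zeroLocus F ∨ Z ⊆ zeroLocus G) :
    IsIrreducible Z := by
  refine ⟨hne, ?_⟩
  rintro U V hU hV ⟨p, hpZ, hpU⟩ ⟨q, hqZ, hqV⟩
  obtain ⟨F, d, hF, hpF, hFU⟩ := exists_subset_of_isOpen hU hpU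
  obtain ⟨G, e, hG, hqG, hGV⟩ := exists_subset_of_isOpen hV hqV
  by_contra hcon
  rcases h F G d e hF hG (fun r hr => by
    by_contra hr'
    rw [zeroLocus_mul, Set.mem_union, not_or] at hr'
    exact hcon ⟨r, hr, hFU hr'.1, hGV hr'.2⟩) with h | h
  · exact hpF (h hpZ)
  · exact hqG (h hqZ)

/-! ### Affine charts -/

/-- A choice of one coordinate in every factor; it determines an affine chart. -/
abbrev Frame (m : ℕ) : Type := ∀ k : Option (Fin m), {c : Coord m // factor c = k}

namespace Frame

variable {m : ℕ} (v : Frame m)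

/-- The coordinate is one of those that are set to `1` in the chart. -/
def Mem (c : Coord m) : Prop := c = (v (factor c)).1

instance : DecidablePred v.Mem := fun c => inferInstanceAs (Decidable (c = _))

lemma mem_apply (k : Option (Fin m)) : v.Mem (v k).1 := by
  unfold Mem
  rw [(v k).2]

/-- The affine coordinates of the chart. -/
abbrev Var : Type := {c : Coord m // ¬ v.Mem c}

/-- This is the dimension of the product, one more than the number of players; the bounds `m + 2`
and `m + 3` on codimensions below come from here. -/
lemma card_var : Fintype.card v.Var = m + 3 := by
  have h : Fintype.card {c : Coord m // v.Mem c} = m + 1 := by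
    rw [← Fintype.card_congr (Equiv.ofBijective
      (fun k => (⟨(v k).1, v.mem_apply k⟩ : {c : Coord m // v.Mem c})) ⟨?_, ?_⟩)]
    · simp
    · intro k l h
      rw [← (v k).2, ← (v l).2, congrArg Subtype.val h]
    · rintro ⟨c, hc⟩
      exact ⟨factor c, Subtype.ext hc.symm⟩
  have h2 := Fintype.card_subtype_compl v.Mem
  rw [h] at h2
  change Fintype.card {c : Coord m // ¬ v.Mem c} = _
  rw [h2]
  simp
  omega

/-- The homogeneous coordinates of a point of the chart. -/
def extend (u : v.Var → ℂ) (c : Coord m) : ℂ := if h : v.Mem c then 1 else u ⟨c, h⟩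

lemma extend_apply (u : v.Var → ℂ) (k : Option (Fin m)) : v.extend u (v k).1 = 1 := by
  simp [extend, v.mem_apply]

lemma relevant_extend (u : v.Var → ℂ) : Relevant (v.extend u) :=
  fun k => ⟨v k, (v k).2, by simp [extend_apply]⟩

/-- The point of the chart with given affine coordinates. -/
noncomputable def point (u : v.Var → ℂ) : Segre m := ofCoord (v.extend u) (v.relevant_extend u)

/-- The product of the coordinates that are invertible in the chart. -/
noncomputable def denom : CoordRing m := ∏ k, X (v k).1

lemma isMultihomogeneous_denom : IsMultihomogeneous v.denom 1 := by
  have := IsWeightedHomogeneous.prod (R := ℂ)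
    (w := fun c : Coord m => (Pi.single (factor c) 1 : Option (Fin m) → ℕ)) Finset.univ
    (fun k => X (v k).1) (fun k => Pi.single k 1) (fun k _ => by
      have h := isWeightedHomogeneous_X ℂ
        (fun c : Coord m => (Pi.single (factor c) 1 : Option (Fin m) → ℕ)) (v k).1
      rwa [(v k).2] at h)
  have h1 : ∑ k : Option (Fin m), (Pi.single k 1 : Option (Fin m) → ℕ) = 1 :=
    Finset.univ_sum_single 1
  rwa [h1] at this

lemma notMem_zeroLocus_denom {p : Segre m} :
    p ∉ zeroLocus v.denom ↔ ∀ k, p.coord (v k).1 ≠ 0 := by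
  simp only [zeroLocus, denom, map_prod, eval_X, Set.mem_ofPred_eq, Finset.prod_eq_zero_iff]
  simp only [Finset.mem_univ, true_and, not_exists, ne_eq]

lemma exists_point_eq {p : Segre m} (h : p ∉ zeroLocus v.denom) : ∃ u, v.point u = p := by
  rw [notMem_zeroLocus_denom] at h
  refine ⟨fun c => p.coord c / p.coord (v (factor c.1)).1, ?_⟩
  refine Eq.trans ?_ (ofCoord_coord p)
  refine ofCoord_eq_ofCoord _ _ (fun k => p.coord (v k).1) fun c => ?_
  unfold extend
  split_ifs with hc
  · rw [mul_one, ← hc]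
  · exact (mul_div_cancel₀ _ (h _)).symm

lemma point_notMem (u : v.Var → ℂ) : v.point u ∉ zeroLocus v.denom := by
  rw [point, ofCoord_mem_zeroLocus v.isMultihomogeneous_denom]
  simp [denom, extend_apply]

lemma exists_frame (p : Segre m) : ∃ v : Frame m, p ∉ zeroLocus v.denom := by
  choose c hc hne using p.relevant_coord
  exact ⟨fun k => ⟨c k, hc k⟩, (notMem_zeroLocus_denom _).2 hne⟩

/-- Dehomogenization. -/
noncomputable def dehom : CoordRing m →ₐ[ℂ] MvPolynomial v.Var ℂ :=
  aeval fun c => if h : v.Mem c then 1 else X ⟨c, h⟩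

lemma eval_dehom (u : v.Var → ℂ) (F : CoordRing m) :
    eval u (v.dehom F) = eval (v.extend u) F := by
  have : (eval u).comp v.dehom.toRingHom = eval (v.extend u) := by
    refine ringHom_ext (fun r => ?_) fun c => ?_
    · simp [dehom]
    · by_cases h : v.Mem c <;> simp [dehom, extend, h]
  exact congrArg (fun f => f F) this

lemma point_mem_zeroLocus {F : CoordRing m} {d : Option (Fin m) → ℕ} (hF : IsMultihomogeneous F d)
    (u : v.Var → ℂ) : v.point u ∈ zeroLocus F ↔ eval u (v.dehom F) = 0 := by
  rw [point, ofCoord_mem_zeroLocus hF, eval_dehom]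

lemma dehom_X_apply (k : Option (Fin m)) : v.dehom (X (v k).1) = 1 := by
  simp [dehom, v.mem_apply]

/-- Having a homogenization in every large degree `D • δ`, not just in one, lets several polynomials
be lifted to forms of a common degree. -/
lemma exists_dehom_eq (δ : Option (Fin m) → ℕ) (hδ : ∀ k, 1 ≤ δ k) (q : MvPolynomial v.Var ℂ) :
    ∃ D₀ : ℕ, ∀ D ≥ D₀, ∃ F, IsMultihomogeneous F (D • δ) ∧ v.dehom F = q := by
  have hX (k : Option (Fin m)) : IsMultihomogeneous (X (v k).1) (Pi.single k 1) := by
    have h := isWeightedHomogeneous_X ℂ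
      (fun c : Coord m => (Pi.single (factor c) 1 : Option (Fin m) → ℕ)) (v k).1
    rwa [(v k).2] at h
  have hpow (e : Option (Fin m) → ℕ) :
      ∃ F, IsMultihomogeneous F e ∧ v.dehom F = 1 := by
    refine ⟨∏ k, X (v k).1 ^ e k, ?_, by simp [map_prod, dehom_X_apply]⟩
    have h1 := IsWeightedHomogeneous.prod (R := ℂ)
      (w := fun c : Coord m => (Pi.single (factor c) 1 : Option (Fin m) → ℕ)) Finset.univ
      (fun k => X (v k).1 ^ e k) (fun k => e k • Pi.single k 1) (fun k _ => (hX k).pow _)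
    have h2 : ∑ k, e k • (Pi.single k 1 : Option (Fin m) → ℕ) = e := by
      conv_rhs => rw [← Finset.univ_sum_single e]
      refine Finset.sum_congr rfl fun k _ => ?_
      rw [← Pi.single_smul]
      simp
    rwa [h2] at h1
  induction q using MvPolynomial.induction_on with
  | C a =>
    refine ⟨0, fun D _ => ?_⟩
    obtain ⟨F, hF, hF1⟩ := hpow (D • δ)
    exact ⟨C a * F, hF.C_mul a, by simp [hF1]⟩
  | add p q hp hq =>
    obtain ⟨D₁, h1⟩ := hp
    obtain ⟨D₂, h2⟩ := hq
    refine ⟨max D₁ D₂, fun D hD => ?_⟩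
    obtain ⟨F, hF, rfl⟩ := h1 D (le_of_max_le_left hD)
    obtain ⟨G, hG, rfl⟩ := h2 D (le_of_max_le_right hD)
    exact ⟨F + G, hF.add hG, map_add _ _ _⟩
  | mul_X p c hp =>
    obtain ⟨D₁, h1⟩ := hp
    refine ⟨D₁ + 1, fun D hD => ?_⟩
    obtain ⟨F, hF, rfl⟩ := h1 (D - 1) (by omega)
    obtain ⟨G, hG, hG1⟩ := hpow (δ - Pi.single (factor c.1) 1)
    refine ⟨F * X c.1 * G, ?_, ?_⟩
    · have h3 := (hF.mul (isWeightedHomogeneous_X ℂ _ c.1)).mul hG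
      have h4 : (D - 1) • δ + Pi.single (factor c.1) 1 + (δ - Pi.single (factor c.1) 1)
          = D • δ := by
        obtain ⟨D', rfl⟩ : ∃ D', D = D' + 1 := ⟨D - 1, by omega⟩
        have h5 : (Pi.single (factor c.1) 1 : Option (Fin m) → ℕ) ≤ δ := by
          intro k
          by_cases h : k = factor c.1
          · subst h; simpa using hδ _
          · simp [h]
        rw [add_assoc, add_tsub_cancel_of_le h5, add_smul, one_smul]
        simp
      exact h4 ▸ h3
    · rw [map_mul, map_mul, hG1, mul_one]
      congr 1
      simp [dehom, c.2]

/-! ### Irreducible closed sets and prime ideals of the chart -/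

/-- The ideal of a subset in the chart. -/
noncomputable def ideal (Z : Set (Segre m)) : Ideal (MvPolynomial v.Var ℂ) :=
  vanishingIdeal ℂ (v.point ⁻¹' Z)

lemma mem_ideal {Z : Set (Segre m)} {q : MvPolynomial v.Var ℂ} :
    q ∈ v.ideal Z ↔ ∀ u, v.point u ∈ Z → eval u q = 0 := Iff.rfl

/-- The subset meets the chart. -/
def Meets (Z : Set (Segre m)) : Prop := ∃ p ∈ Z, p ∉ zeroLocus v.denom

variable {v}

/-- Vanishing on the chart propagates: `Z` lies in `𝕍(F) ∪ 𝕍(denom)`, and being irreducible and not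
inside `𝕍(denom)` it lies in `𝕍(F)`. -/
lemma dehom_mem_ideal {Z : Set (Segre m)} (hZ : IsIrreducible Z) (hv : v.Meets Z)
    {F : CoordRing m} {d : Option (Fin m) → ℕ} (hF : IsMultihomogeneous F d) :
    v.dehom F ∈ v.ideal Z ↔ Z ⊆ zeroLocus F := by
  constructor
  · intro h
    rcases subset_or_subset_of_mul hZ hF v.isMultihomogeneous_denom (by
      intro p hp
      rw [zeroLocus_mul]
      by_cases hpd : p ∈ zeroLocus v.denom
      · exact .inr hpd
      · obtain ⟨u, rfl⟩ := v.exists_point_eq hpd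
        exact .inl ((v.point_mem_zeroLocus hF u).2 (h u hp))) with h | h
    · exact h
    · obtain ⟨p, hp, hpd⟩ := hv
      exact absurd (h hp) hpd
  · intro h u hu
    exact (v.point_mem_zeroLocus hF u).1 (h hu)

lemma isPrime_ideal {Z : Set (Segre m)} (hZ : IsIrreducible Z) (hv : v.Meets Z) :
    (v.ideal Z).IsPrime := by
  constructor
  · obtain ⟨p, hp, hpd⟩ := hv
    obtain ⟨u, rfl⟩ := v.exists_point_eq hpd
    intro h
    have h1 : (1 : MvPolynomial v.Var ℂ) ∈ v.ideal Z := h ▸ Submodule.mem_top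
    simpa using v.mem_ideal.1 h1 u hp
  · intro q r hqr
    obtain ⟨D₁, h1⟩ := v.exists_dehom_eq 1 (fun _ => le_rfl) q
    obtain ⟨D₂, h2⟩ := v.exists_dehom_eq 1 (fun _ => le_rfl) r
    obtain ⟨F, hF, rfl⟩ := h1 D₁ le_rfl
    obtain ⟨G, hG, rfl⟩ := h2 D₂ le_rfl
    rw [← map_mul, dehom_mem_ideal hZ hv (hF.mul hG)] at hqr
    rw [dehom_mem_ideal hZ hv hF, dehom_mem_ideal hZ hv hG]
    exact subset_or_subset_of_mul hZ hF hG hqr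

lemma ideal_le_ideal {W Z : Set (Segre m)} (hW : IsClosed W) (hWi : IsIrreducible W)
    (hWv : v.Meets W) (hZi : IsIrreducible Z) (hZv : v.Meets Z) :
    v.ideal W ≤ v.ideal Z ↔ Z ⊆ W := by
  constructor
  · intro h p hp
    refine mem_of_forall_zeroLocus hW fun F d hF hWF => ?_
    exact (dehom_mem_ideal hZi hZv hF).1 (h ((dehom_mem_ideal hWi hWv hF).2 hWF)) hp
  · intro h q hq u hu
    exact hq u (h hu)

/-- `W` is the closure of the affine variety of `P`. Inside the chart it has the same points as that
variety, so the affine Nullstellensatz recovers `P` as its ideal, and primality of `P` makes `W`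
irreducible. -/
lemma exists_ideal_eq (P : Ideal (MvPolynomial v.Var ℂ)) [P.IsPrime] :
    ∃ W : TopologicalSpace.IrreducibleCloseds (Segre m), v.Meets W ∧ v.ideal (W : Set (Segre m)) = P := by
  set W : Set (Segre m) := ⋂ (F : CoordRing m) (d : Option (Fin m) → ℕ)
    (_ : IsMultihomogeneous F d) (_ : v.dehom F ∈ P), zeroLocus F with hW
  have hWc : IsClosed W := isClosed_iInter fun F => isClosed_iInter fun d => isClosed_iInter fun hF =>
    isClosed_iInter fun _ => isClosed_zeroLocus hF
  have hmem (p : Segre m) : p ∈ W ↔ ∀ (F : CoordRing m) (d : Option (Fin m) → ℕ),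
    IsMultihomogeneous F d → v.dehom F ∈ P → p ∈ zeroLocus F := by simp [hW]
  have hpt (u : v.Var → ℂ) : v.point u ∈ W ↔ u ∈ MvPolynomial.zeroLocus ℂ P := by
    rw [hmem]
    constructor
    · intro h q hq
      obtain ⟨D, hD⟩ := v.exists_dehom_eq 1 (fun _ => le_rfl) q
      obtain ⟨F, hF, rfl⟩ := hD D le_rfl
      exact (v.point_mem_zeroLocus hF u).1 (h F _ hF hq)
    · intro h F d hF hFP
      exact (v.point_mem_zeroLocus hF u).2 (h _ hFP)
  have hid : v.ideal W = P := by
    rw [ideal, show v.point ⁻¹' W = MvPolynomial.zeroLocus ℂ P from Set.ext hpt]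
    exact IsPrime.vanishingIdeal_zeroLocus P
  have hne : (MvPolynomial.zeroLocus ℂ P).Nonempty := by
    rw [Set.nonempty_iff_ne_empty]
    intro h
    have h1 := IsPrime.vanishingIdeal_zeroLocus (K := ℂ) P
    rw [h, vanishingIdeal_empty] at h1
    exact Ideal.IsPrime.ne_top ‹_› h1.symm
  obtain ⟨u, hu⟩ := hne
  have hWi : IsIrreducible W := by
    refine isIrreducible_of_mul ⟨_, (hpt u).2 hu⟩ fun F G d e hF hG h => ?_
    have h1 : v.dehom F * v.dehom G ∈ P := by
      rw [← map_mul, ← hid]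
      intro u hu
      exact (v.point_mem_zeroLocus (hF.mul hG) u).1 (h hu)
    rcases Ideal.IsPrime.mem_or_mem ‹_› h1 with h1 | h1
    · exact .inl fun p hp => (hmem p).1 hp F d hF h1
    · exact .inr fun p hp => (hmem p).1 hp G e hG h1
  exact ⟨⟨W, hWi, hWc⟩, ⟨_, (hpt u).2 hu, v.point_notMem u⟩, hid⟩

lemma Meets.mono {Z W : Set (Segre m)} (h : v.Meets Z) (hZW : Z ⊆ W) : v.Meets W :=
  let ⟨p, hp, hpd⟩ := h
  ⟨p, hZW hp, hpd⟩

/-- The irreducible closed sets above `Z` correspond to the prime ideals below that of `Z`. -/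
lemma coheight_eq_height_ideal (Z : TopologicalSpace.IrreducibleCloseds (Segre m))
    (hv : v.Meets (Z : Set (Segre m))) : Order.coheight Z = (v.ideal (Z : Set (Segre m))).height := by
  have hprime := isPrime_ideal Z.isIrreducible hv
  refine Eq.trans ?_ (PrimeSpectrum.height_eq_orderHeight ⟨_, hprime⟩).symm
  apply WithBot.coe_injective
  rw [Order.coheight_eq_krullDim_Ici, Order.height_eq_krullDim_Iic, 
    ← Order.krullDim_orderDual (α := Set.Iic _)]
  let f : Set.Ici Z → (Set.Iic (⟨_, hprime⟩ : PrimeSpectrum (MvPolynomial v.Var ℂ)))ᵒᵈ := fun W =>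
    OrderDual.toDual ⟨⟨v.ideal (W.1 : Set (Segre m)), isPrime_ideal W.1.isIrreducible (hv.mono W.2)⟩,
      (ideal_le_ideal W.1.isClosed W.1.isIrreducible (hv.mono W.2) Z.isIrreducible hv).2 W.2⟩
  have hf (W W' : Set.Ici Z) : f W ≤ f W' ↔ W ≤ W' :=
    ideal_le_ideal W'.1.isClosed W'.1.isIrreducible (hv.mono W'.2) W.1.isIrreducible (hv.mono W.2)
  refine Order.krullDim_eq_of_orderIso
    (RelIso.ofSurjective (OrderEmbedding.ofMapLEIff f hf) fun P => ?_)
  obtain ⟨⟨P, hP⟩, hPZ⟩ := P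
  obtain ⟨W, hW, rfl⟩ := exists_ideal_eq P
  exact ⟨⟨W, (ideal_le_ideal W.isClosed W.isIrreducible hW Z.isIrreducible hv).1 hPZ⟩, rfl⟩

end Frame

/-! ### The height of a prime ideal and the transcendence degree of its quotient -/

lemma trdeg_quotient_comap_le {k R S : Type} [Field k] [CommRing R] [CommRing S] [Algebra k R]
    [Algebra k S] (f : R →ₐ[k] S) (P : Ideal S) :
    Algebra.trdeg k (R ⧸ P.comap f) ≤ Algebra.trdeg k (S ⧸ P) :=
  trdeg_le_of_injective (Ideal.quotientMapₐ P f le_rfl)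
    (Ideal.quotientMap_injective' (H := le_rfl) le_rfl)

lemma trdeg_polynomial {k A : Type} [Field k] [CommRing A] [IsDomain A] [Algebra k A] :
    Algebra.trdeg k (Polynomial A) = Algebra.trdeg k A + 1 := by
  rw [← trdeg_add_eq k A (A := Polynomial A), Polynomial.trdeg_of_isDomain]

lemma trdeg_quotient_map_C {k R : Type} [Field k] [CommRing R] [Algebra k R] (p : Ideal R)
    [p.IsPrime] :
    Algebra.trdeg k (Polynomial R ⧸ p.map (Polynomial.C : R →+* Polynomial R)) =
      Algebra.trdeg k (R ⧸ p) + 1 := by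
  rw [← trdeg_polynomial]
  refine (AlgEquiv.trdeg_eq (AlgEquiv.ofRingEquiv
    (f := p.polynomialQuotientEquivQuotientPolynomial) fun r => ?_)).symm
  have := Ideal.polynomialQuotientEquivQuotientPolynomial_map_mk p
    (Polynomial.C (algebraMap k R r))
  rw [Polynomial.map_C] at this
  exact this

/-- The extension of the contracted prime is a prime strictly below `P`, and by going-down from `R`
to its polynomial ring it has at least the height of the contraction. -/
lemma height_comap_C_add_one_le {R : Type} [CommRing R] [IsNoetherianRing R]
    (P : Ideal (Polynomial R)) [P.IsPrime]
    (h : (P.comap (Polynomial.C : R →+* Polynomial R)).map Polynomial.C ≠ P) :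
    (P.comap (Polynomial.C : R →+* Polynomial R)).height + 1 ≤ P.height := by
  set p := P.comap (Polynomial.C : R →+* Polynomial R) with hp
  have hpp : p.IsPrime := Ideal.comap_isPrime _ _
  have hq : (p.map (Polynomial.C : R →+* Polynomial R)).IsPrime := Ideal.isPrime_map_C_of_isPrime
  have hlt : p.map (Polynomial.C : R →+* Polynomial R) < P :=
    lt_of_le_of_ne Ideal.map_comap_le h
  refine le_trans ?_ (Ideal.height_add_one_le_of_lt_of_isPrime hlt)
  gcongr
  have : (p.map (Polynomial.C : R →+* Polynomial R)).LiesOver p := by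
    refine ⟨le_antisymm Ideal.le_comap_map fun r hr => ?_⟩
    simpa using Ideal.mem_map_C_iff.1 hr 0
  rw [Ideal.height_eq_height_add_of_liesOver_of_hasGoingDown p
    (p.map (Polynomial.C : R →+* Polynomial R))]
  exact le_self_add

/-- A prime ideal in a polynomial ring in finitely many variables satisfies
`dim ≤ height + trdeg`. -/
theorem card_le_height_add {k ι : Type} [Field k] [Finite ι] (P : Ideal (MvPolynomial ι k))
    [P.IsPrime] (r : ℕ) (hr : Algebra.trdeg k (MvPolynomial ι k ⧸ P) ≤ r) :
    (Nat.card ι : ℕ∞) ≤ P.height + r := by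
  induction ι using Finite.induction_empty_option generalizing r with
  | @of_equiv α β e ih =>
    let f := renameEquiv k e
    have h1 := ih (P.comap (f : MvPolynomial α k →ₐ[k] MvPolynomial β k)) r
      ((trdeg_quotient_comap_le _ P).trans hr)
    rw [Nat.card_congr e] at h1
    exact h1.trans_eq (congrArg (· + (r : ℕ∞)) (f.toRingEquiv.height_comap P))
  | h_empty => simp
  | @h_option α _ ih =>
    let f := (optionEquivLeft k α).symm
    set Q : Ideal (Polynomial (MvPolynomial α k)) :=
      P.comap (f : Polynomial (MvPolynomial α k) →ₐ[k] MvPolynomial (Option α) k) with hQ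
    have hQr : Algebra.trdeg k (Polynomial (MvPolynomial α k) ⧸ Q) ≤ r :=
      (trdeg_quotient_comap_le _ P).trans hr
    have hQh : Q.height = P.height := f.toRingEquiv.height_comap P
    have hQp : Q.IsPrime := Ideal.comap_isPrime _ _
    rw [← hQh, Nat.card_eq_fintype_card, Fintype.card_option, ← Nat.card_eq_fintype_card]
    set p := Q.comap (Polynomial.C : MvPolynomial α k →+* _) with hp
    have hpp : p.IsPrime := Ideal.comap_isPrime _ _
    -- If `Q` is extended from `p`, the new variable stays transcendental modulo `Q`, so the
    -- transcendence degree for `p` is one less. Otherwise the height grows by at least one from `p`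
    -- to `Q`, while the transcendence degree for `p` is still at most `r`.
    by_cases h : p.map Polynomial.C = Q
    · rw [← h, trdeg_quotient_map_C] at hQr
      obtain ⟨r', rfl⟩ : ∃ r', r = r' + 1 := by
        refine Nat.exists_eq_succ_of_ne_zero ?_
        rintro rfl
        simp at hQr
      have h1 := ih p r' (by
        push_cast at hQr
        exact (Cardinal.add_one_le_add_one_iff).1 hQr)
      have h2 : p.height ≤ Q.height := by
        have : Q.LiesOver p := ⟨rfl⟩
        rw [Ideal.height_eq_height_add_of_liesOver_of_hasGoingDown p Q]
        exact le_self_add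
      push_cast
      rw [← add_assoc]
      gcongr
      exact h1.trans (by gcongr)
    · have h1 := ih p r ((trdeg_quotient_comap_le
        (IsScalarTower.toAlgHom k (MvPolynomial α k) (Polynomial (MvPolynomial α k))) Q).trans hQr)
      have h2 := height_comap_C_add_one_le Q h
      push_cast
      calc (Nat.card α : ℕ∞) + 1 ≤ p.height + r + 1 := by gcongr
        _ = p.height + 1 + r := by ring
        _ ≤ _ := by gcongr

/-! ### The multigraded Nullstellensatz -/

/-- The multi-degrees of the coordinates. -/
abbrev coordWeight (m : ℕ) : Coord m → Option (Fin m) → ℕ := fun c => Pi.single (factor c) 1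

lemma weight_coordWeight_apply {m : ℕ} (μ : Coord m →₀ ℕ) (k : Option (Fin m)) :
    Finsupp.weight (coordWeight m) μ k = ∑ c with factor c = k, μ c := by
  rw [Finsupp.weight_apply, Finsupp.sum_fintype _ _ (by simp), Finset.sum_apply, Finset.sum_filter]
  refine Finset.sum_congr rfl fun c _ => ?_
  by_cases h : factor c = k
  · subst h; simp
  · simp [h, Ne.symm h]

lemma finite_weight_eq {m : ℕ} (e : Option (Fin m) → ℕ) :
    {μ : Coord m →₀ ℕ | Finsupp.weight (coordWeight m) μ = e}.Finite := by
  refine (Set.finite_Iic (Finsupp.equivFunOnFinite.symm fun c : Coord m => e (factor c))).subset ?_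
  rintro μ rfl c
  change μ c ≤ Finsupp.weight (coordWeight m) μ (factor c)
  rw [weight_coordWeight_apply]
  exact Finset.single_le_sum (f := fun c => μ c) (fun _ _ => Nat.zero_le _) (by simp)

instance {m : ℕ} (e : Option (Fin m) → ℕ) :
    Module.Finite ℂ (weightedHomogeneousSubmodule ℂ (coordWeight m) e) := by
  rw [weightedHomogeneousSubmodule_eq_finsupp_supported]
  have := (finite_weight_eq e).to_subtype
  exact Module.Finite.equiv (AddMonoidAlgebra.supportedEquivFinsupp _).symm

lemma Frame.denom_eq_monomial {m : ℕ} (v : Frame m) :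
    v.denom = monomial (∑ k, Finsupp.single (v k).1 1) 1 := by
  rw [denom, monomial_sum_one]
  rfl

lemma Frame.sum_single_apply {m : ℕ} (v : Frame m) (c : Coord m) :
    (∑ k, Finsupp.single (v k).1 1 : Coord m →₀ ℕ) c = if v.Mem c then 1 else 0 := by
  rw [Finsupp.finsetSum_apply]
  simp only [Finsupp.single_apply]
  rw [Finset.sum_eq_single (factor c)]
  · exact if_congr (by rw [Frame.Mem, eq_comm]) rfl rfl
  · intro k _ hk
    rw [if_neg]
    rintro rfl
    exact hk (v k).2.symm
  · simp

/-- An affine zero of `I` is not relevant, so all coordinates of some factor vanish there, including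
the one that divides `denom`. The affine Nullstellensatz concludes. -/
lemma denom_mem_radical {m : ℕ} {I : Ideal (CoordRing m)}
    (hI : ∀ x, Relevant x → ∃ F ∈ I, eval x F ≠ 0) (v : Frame m) : v.denom ∈ I.radical := by
  rw [← vanishingIdeal_zeroLocus_eq_radical (K := ℂ)]
  intro x hx
  have hrel : ¬ Relevant x := fun h => by
    obtain ⟨F, hF, hne⟩ := hI x h
    exact hne (hx F hF)
  simp only [Relevant, not_forall, not_exists, not_and, not_not] at hrel
  obtain ⟨k, hk⟩ := hrel
  rw [Frame.denom, map_prod]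
  exact Finset.prod_eq_zero (Finset.mem_univ k) (by simp [hk _ (v k).2])

/-- An ideal without zeros in `(ℙ¹)^m × ℙ³` contains all forms of large multi-degree. -/
lemma exists_forall_mem {m : ℕ} {I : Ideal (CoordRing m)}
    (hI : ∀ x, Relevant x → ∃ F ∈ I, eval x F ≠ 0) :
    ∃ n : ℕ, ∀ (e : Option (Fin m) → ℕ), (∀ k, n ≤ e k) →
      ∀ F, IsMultihomogeneous F e → F ∈ I := by
  choose n hn using fun v : Frame m => denom_mem_radical hI v
  set N := ∑ v, n v with hN
  have hpow (v : Frame m) : v.denom ^ N ∈ I :=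
    Ideal.mem_of_dvd _ (pow_dvd_pow _ (Finset.single_le_sum (fun _ _ => Nat.zero_le _)
      (Finset.mem_univ v))) (hn v)
  -- A factor has at most four coordinates, so degree `4 * N` in it forces some exponent to be at
  -- least `N`. The frame of these coordinates has a `denom ^ N` that divides the monomial.
  refine ⟨4 * N, fun e he F hF => ?_⟩
  rw [F.as_sum]
  refine Ideal.sum_mem _ fun μ hμ => ?_
  have hw := hF (mem_support_iff.1 hμ)
  have hex (k : Option (Fin m)) : ∃ c : Coord m, factor c = k ∧ N ≤ μ c := by
    have hne : ({c | factor c = k} : Finset (Coord m)).Nonempty := by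
      rcases k with _ | i
      · exact ⟨.inr 0, Finset.mem_filter.2 ⟨Finset.mem_univ _, rfl⟩⟩
      · exact ⟨.inl (i, 0), Finset.mem_filter.2 ⟨Finset.mem_univ _, rfl⟩⟩
    have hcard : ({c | factor c = k} : Finset (Coord m)).card ≤ 4 := by
      rcases k with _ | i
      · refine (Finset.card_le_card (t := Finset.univ.image
          (Sum.inr : Fin 2 × Fin 2 → Coord m)) ?_).trans
          (Finset.card_image_le.trans (by simp))
        rintro (c | c) hc <;> replace hc := (Finset.mem_filter.1 hc).2
        · simp [factor] at hc
        · simp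
      · refine (Finset.card_le_card (t := Finset.univ.image
          (fun j : Fin 2 => (.inl (i, j) : Coord m))) ?_).trans
          (Finset.card_image_le.trans (by simp))
        rintro (⟨i', j⟩ | c) hc <;> replace hc := (Finset.mem_filter.1 hc).2
        · obtain rfl : i' = i := by simpa [factor] using hc
          simp
        · simp [factor] at hc
    have hle : ∑ c with factor c = k, N ≤ ∑ c with factor c = k, μ c := by
      rw [← weight_coordWeight_apply, hw, Finset.sum_const, smul_eq_mul]
      exact (Nat.mul_le_mul_right _ hcard).trans (he k)
    obtain ⟨c, hc, hle⟩ := Finset.exists_le_of_sum_le hne hle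
    exact ⟨c, (Finset.mem_filter.1 hc).2, hle⟩
  choose c hc hNc using hex
  let v : Frame m := fun k => ⟨c k, hc k⟩
  refine Ideal.mem_of_dvd _ ?_ (hpow v)
  rw [v.denom_eq_monomial, monomial_pow, one_pow, monomial_dvd_monomial]
  refine ⟨.inr fun a => ?_, one_dvd _⟩
  rw [Finsupp.smul_apply, v.sum_single_apply]
  split_ifs with h
  · have h2 : a = c (factor a) := h
    rw [smul_eq_mul, mul_one, h2]
    exact hNc _
  · simp

open Classical in
/-- The form of degree `e` in the product of any polynomial with a form of degree `d`. -/
lemma component_mul {m : ℕ} {F : CoordRing m} {d : Option (Fin m) → ℕ}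
    (hF : IsMultihomogeneous F d) (e : Option (Fin m) → ℕ) (A : CoordRing m) :
    weightedHomogeneousComponent (coordWeight m) e (A * F) =
      if d ≤ e then weightedHomogeneousComponent (coordWeight m) (e - d) A * F else 0 := by
  induction A using MvPolynomial.induction_on' with
  | monomial μ r =>
    have h1 := isWeightedHomogeneous_monomial (R := ℂ) (coordWeight m) μ r rfl
    rw [weightedHomogeneousComponent_of_mem h1, weightedHomogeneousComponent_of_mem (h1.mul hF)]
    by_cases h : d ≤ e
    · rw [if_pos h]
      by_cases h2 : e - d = Finsupp.weight (coordWeight m) μ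
      · rw [if_pos h2, if_pos (by rw [← h2, tsub_add_cancel_of_le h])]
      · rw [if_neg h2, if_neg, zero_mul]
        rintro rfl
        exact h2 (add_tsub_cancel_right _ _)
    · rw [if_neg h, if_neg]
      rintro rfl
      exact h le_add_self
  | add p q hp hq =>
    rw [add_mul, map_add, map_add, hp, hq]
    split_ifs <;> ring

lemma component_add_mul {m : ℕ} {F : CoordRing m} {d : Option (Fin m) → ℕ}
    (hF : IsMultihomogeneous F d) (e : Option (Fin m) → ℕ) (A : CoordRing m) :
    weightedHomogeneousComponent (coordWeight m) (e + d) (A * F) =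
      weightedHomogeneousComponent (coordWeight m) e A * F := by
  rw [component_mul hF, if_pos le_add_self, add_tsub_cancel_right]

/-- Modulo the forms that vanish on `Z`, two forms of the same degree `δ` without common zeros
on `Z` generate all forms whose degree is a large multiple of `δ`. -/
lemma exists_sub_mul_vanish {m : ℕ} {Z : Set (Segre m)} (hZ : IsClosed Z) {δ : Option (Fin m) → ℕ}
    (hδ : ∀ k, 1 ≤ δ k) {H₁ H₂ : CoordRing m} (h1 : IsMultihomogeneous H₁ δ)
    (h2 : IsMultihomogeneous H₂ δ) (hH : Z ∩ zeroLocus H₁ ∩ zeroLocus H₂ = ∅) :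
    ∃ N₀ : ℕ, ∀ N ≥ N₀, ∀ G, IsMultihomogeneous G ((N + 1) • δ) →
      ∃ A₁ A₂, IsMultihomogeneous A₁ (N • δ) ∧ IsMultihomogeneous A₂ (N • δ) ∧
        Z ⊆ zeroLocus (G - (A₁ * H₁ + A₂ * H₂)) := by
  set J : Ideal (CoordRing m) :=
    Ideal.span {F | ∃ d, IsMultihomogeneous F d ∧ Z ⊆ zeroLocus F} with hJ
  -- The arbitrary multiplier `A` is carried along so that the induction over the span passes
  -- through scalar multiplication.
  have hJmul (P : CoordRing m) (hP : P ∈ J) : ∀ (A : CoordRing m) (e : Option (Fin m) → ℕ),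
      Z ⊆ zeroLocus (weightedHomogeneousComponent (coordWeight m) e (A * P)) := by
    induction hP using Submodule.span_induction with
    | mem P hP =>
      intro A e p hp
      obtain ⟨d, hd, hPZ⟩ := hP
      have hPp : eval p.coord P = 0 := hPZ hp
      rw [component_mul hd]
      split_ifs <;> simp [zeroLocus, hPp]
    | zero => simp [zeroLocus]
    | add P Q _ _ hP hQ =>
      intro A e p hp
      have h1 : eval p.coord _ = 0 := hP A e hp
      have h2 : eval p.coord _ = 0 := hQ A e hp
      change eval p.coord _ = 0
      rw [mul_add, map_add, map_add, h1, h2, add_zero]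
    | smul B P _ hP =>
      intro A e
      rw [smul_eq_mul, ← mul_assoc]
      exact hP (A * B) e
  have hJc (P : CoordRing m) (hP : P ∈ J) (e : Option (Fin m) → ℕ) :
      Z ⊆ zeroLocus (weightedHomogeneousComponent (coordWeight m) e P) := by
    simpa using hJmul P hP 1 e
  have hrel : ∀ x, Relevant x → ∃ F ∈ J ⊔ Ideal.span {H₁, H₂}, eval x F ≠ 0 := by
    intro x hx
    by_contra! hcon
    have hxZ : ofCoord x hx ∈ Z := mem_of_forall_zeroLocus hZ fun F d hF hFZ =>
      (ofCoord_mem_zeroLocus hF x hx).2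
        (hcon F (Ideal.mem_sup_left (Ideal.subset_span ⟨d, hF, hFZ⟩)))
    have : ofCoord x hx ∈ Z ∩ zeroLocus H₁ ∩ zeroLocus H₂ :=
      ⟨⟨hxZ, (ofCoord_mem_zeroLocus h1 x hx).2
        (hcon _ (Ideal.mem_sup_right (Ideal.subset_span (by simp))))⟩,
        (ofCoord_mem_zeroLocus h2 x hx).2
          (hcon _ (Ideal.mem_sup_right (Ideal.subset_span (by simp))))⟩
    simp [hH] at this
  obtain ⟨n, hn⟩ := exists_forall_mem hrel
  refine ⟨n, fun N hN G hG => ?_⟩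
  have hGI := hn _ (fun k => hN.trans (by
    change N ≤ (N + 1) * δ k
    nlinarith [hδ k])) G hG
  obtain ⟨P, hP, Q, hQ, rfl⟩ := Submodule.mem_sup.1 hGI
  obtain ⟨A₁, A₂, rfl⟩ := Ideal.mem_span_pair.1 hQ
  refine ⟨weightedHomogeneousComponent (coordWeight m) (N • δ) A₁,
    weightedHomogeneousComponent (coordWeight m) (N • δ) A₂,
    weightedHomogeneousComponent_isWeightedHomogeneous _ _,
    weightedHomogeneousComponent_isWeightedHomogeneous _ _, ?_⟩
  have hcomp := weightedHomogeneousComponent_eq_self hG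
  rw [succ_nsmul] at hcomp
  simp only [map_add, component_add_mul h1, component_add_mul h2] at hcomp
  rw [← hcomp, add_sub_cancel_right]
  exact hJc P hP _

/-- Iterating the previous lemma down to degree `N₀ • δ` expresses a form through the `j + 1`
monomials of degree `j` in `H₁`, `H₂`, with coefficients in a space that does not depend on `j`. -/
lemma exists_sub_sum_vanish {m : ℕ} {Z : Set (Segre m)} (hZ : IsClosed Z)
    {δ : Option (Fin m) → ℕ} (hδ : ∀ k, 1 ≤ δ k) {H₁ H₂ : CoordRing m}
    (h1 : IsMultihomogeneous H₁ δ) (h2 : IsMultihomogeneous H₂ δ)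
    (hH : Z ∩ zeroLocus H₁ ∩ zeroLocus H₂ = ∅) :
    ∃ N₀ : ℕ, ∀ j : ℕ, ∀ G, IsMultihomogeneous G ((N₀ + j) • δ) →
      ∃ A : ℕ → weightedHomogeneousSubmodule ℂ (coordWeight m) (N₀ • δ),
        ∀ p ∈ Z, eval p.coord G = eval p.coord (∑ i ∈ Finset.range (j + 1),
          H₁ ^ i * H₂ ^ (j - i) * (A i).1) := by
  obtain ⟨N₀, hN₀⟩ := exists_sub_mul_vanish hZ hδ h1 h2 hH
  refine ⟨N₀, fun j => ?_⟩
  induction j with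
  | zero => exact fun G hG => ⟨fun _ => ⟨G, hG⟩, by simp⟩
  | succ j ih =>
    intro G hG
    obtain ⟨A₁, A₂, hA₁, hA₂, hA⟩ := hN₀ (N₀ + j) (Nat.le_add_right _ _) G hG
    obtain ⟨B, hB⟩ := ih A₁ hA₁
    obtain ⟨B', hB'⟩ := ih A₂ hA₂
    -- Multiplication by `H₁` shifts the index by one and multiplication by `H₂` keeps it; the
    -- missing end terms are zero.
    refine ⟨fun i => (if i = 0 then 0 else B (i - 1)) + (if i ≤ j then B' i else 0),
      fun p hp => ?_⟩
    have hp' : eval p.coord _ = 0 := hA hp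
    rw [map_sub, sub_eq_zero] at hp'
    rw [hp', map_add, map_mul, map_mul, hB p hp, hB' p hp, ← map_mul, ← map_mul, ← map_add]
    congr 1
    simp only [Submodule.coe_add, mul_add, Finset.sum_add_distrib]
    congr 1
    · rw [Finset.sum_range_succ' _ (j + 1), Finset.sum_mul]
      simp only [if_true, Submodule.coe_zero, mul_zero, add_zero]
      refine Finset.sum_congr rfl fun i _ => ?_
      rw [if_neg i.succ_ne_zero, Nat.add_sub_add_right, Nat.add_sub_cancel]
      ring
    · rw [Finset.sum_range_succ _ (j + 1), if_neg (by omega), Submodule.coe_zero, mul_zero,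
        add_zero, Finset.sum_mul]
      refine Finset.sum_congr rfl fun i hi => ?_
      have hi' : i ≤ j := by simpa [Nat.lt_succ_iff] using hi
      rw [if_pos hi', Nat.sub_add_comm hi', pow_succ]
      ring

/-- The Hilbert function of `Z` in the direction `δ` grows at most linearly. -/
lemma exists_relation {m : ℕ} {Z : Set (Segre m)} (hZ : IsClosed Z)
    {δ : Option (Fin m) → ℕ} (hδ : ∀ k, 1 ≤ δ k) {H₁ H₂ : CoordRing m}
    (h1 : IsMultihomogeneous H₁ δ) (h2 : IsMultihomogeneous H₂ δ)
    (hH : Z ∩ zeroLocus H₁ ∩ zeroLocus H₂ = ∅) :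
    ∃ N₀ c : ℕ, ∀ (j : ℕ) (κ : Type) [Fintype κ] (G : κ → CoordRing m),
      (∀ i, IsMultihomogeneous (G i) ((N₀ + j) • δ)) → (j + 1) * c < Fintype.card κ →
        ∃ a : κ → ℂ, a ≠ 0 ∧ Z ⊆ zeroLocus (∑ i, C (a i) * G i) := by
  obtain ⟨N₀, hN₀⟩ := exists_sub_sum_vanish hZ hδ h1 h2 hH
  set V := weightedHomogeneousSubmodule ℂ (coordWeight m) (N₀ • δ) with hV
  refine ⟨N₀, Module.finrank ℂ V, fun j κ _ G hG hcard => ?_⟩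
  let ev : CoordRing m →ₗ[ℂ] (Z → ℂ) := LinearMap.pi fun p => (aeval (p : Segre m).coord).toLinearMap
  let Φ : (Fin (j + 1) → V) →ₗ[ℂ] (Z → ℂ) := ∑ i : Fin (j + 1),
    (ev ∘ₗ (LinearMap.mulLeft ℂ (H₁ ^ (i : ℕ) * H₂ ^ (j - i)) ∘ₗ V.subtype)) ∘ₗ LinearMap.proj i
  have hmem (i : κ) : ev (G i) ∈ LinearMap.range Φ := by
    obtain ⟨A, hA⟩ := hN₀ j (G i) (hG i)
    refine ⟨fun i => A i, ?_⟩
    funext p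
    refine Eq.trans ?_ (hA p p.2).symm
    rw [map_sum, Finset.sum_range]
    simp [Φ, ev, aeval_eq_eval, mul_assoc]
  have hli : ¬ LinearIndependent ℂ fun i => (⟨ev (G i), hmem i⟩ : LinearMap.range Φ) := by
    intro hli
    have h3 := hli.fintype_card_le_finrank
    have h4 := LinearMap.finrank_range_le Φ
    rw [Module.finrank_pi_fintype] at h4
    simp at h4
    omega
  obtain ⟨a, ha, i, hai⟩ := Fintype.not_linearIndependent_iff.1 hli
  refine ⟨a, fun h => hai (congrFun h i), fun p hp => ?_⟩
  have h5 := congrFun (congrArg Subtype.val ha) ⟨p, hp⟩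
  simpa [zeroLocus, ev, aeval_eq_eval] using h5

/-- Two algebraically independent classes would give `(M + 1) ^ 2` independent monomials with
exponents at most `M`. Their homogenizations live in a degree linear in `M`, where `exists_relation`
leaves room for only linearly many. -/
lemma trdeg_quotient_ideal_le_one {m : ℕ} {Z : Set (Segre m)} (hZ : IsClosed Z)
    (hZi : IsIrreducible Z) {δ : Option (Fin m) → ℕ} (hδ : ∀ k, 1 ≤ δ k) {H₁ H₂ : CoordRing m}
    (h1 : IsMultihomogeneous H₁ δ) (h2 : IsMultihomogeneous H₂ δ)
    (hH : Z ∩ zeroLocus H₁ ∩ zeroLocus H₂ = ∅) (v : Frame m) (hv : v.Meets Z) :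
    Algebra.trdeg ℂ (MvPolynomial v.Var ℂ ⧸ v.ideal Z) ≤ 1 := by
  have hprime := Frame.isPrime_ideal hZi hv
  by_contra! hlt
  obtain ⟨s, hs⟩ := exists_isTranscendenceBasis ℂ (MvPolynomial v.Var ℂ ⧸ v.ideal Z)
  rw [← hs.cardinalMk_eq_trdeg, Cardinal.one_lt_iff_nontrivial] at hlt
  obtain ⟨x, y, hxy⟩ := hlt
  obtain ⟨q, hq⟩ := Ideal.Quotient.mk_surjective x.1
  obtain ⟨r, hr⟩ := Ideal.Quotient.mk_surjective y.1
  have hind : AlgebraicIndependent ℂ (![x.1, y.1] : Fin 2 → _) := by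
    have := hs.1.comp ![x, y] (by
      intro i j
      fin_cases i <;> fin_cases j <;> simp [hxy, hxy.symm])
    convert this using 1
    funext i
    fin_cases i <;> rfl
  obtain ⟨N₀, c, hrel⟩ := exists_relation hZ hδ h1 h2 hH
  obtain ⟨D₀, hD₀⟩ := v.exists_dehom_eq δ hδ 1
  obtain ⟨D₁, hD₁⟩ := v.exists_dehom_eq δ hδ q
  obtain ⟨D₂, hD₂⟩ := v.exists_dehom_eq δ hδ r
  set D := D₀ + D₁ + D₂ + 1 with hD
  obtain ⟨S, hS, hS1⟩ := hD₀ D (by omega)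
  obtain ⟨F, hF, rfl⟩ := hD₁ D (by omega)
  obtain ⟨G, hG, rfl⟩ := hD₂ D (by omega)
  -- Large enough for `(2 * M * D + 1) * c < (M + 1) ^ 2` and for `N₀ ≤ 2 * M * D`.
  set M := 2 * D * c + c + N₀ with hM
  have hNM : N₀ ≤ 2 * M * D := by nlinarith [Nat.zero_le (D * c)]
  have hdeg (i : Fin (M + 1) × Fin (M + 1)) :
      (i.1 : ℕ) * D + i.2 * D + (2 * M - i.1 - i.2) * D = 2 * M * D := by
    rw [← add_mul, ← add_mul]
    congr 1
    have := i.1.2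
    have := i.2.2
    omega
  -- The form `S` dehomogenizes to `1`, so its power only pads the degree.
  have hterm (i : Fin (M + 1) × Fin (M + 1)) : IsMultihomogeneous
      (F ^ (i.1 : ℕ) * G ^ (i.2 : ℕ) * S ^ (2 * M - i.1 - i.2)) ((2 * M * D) • δ) := by
    rw [← hdeg i]
    simp only [add_smul, mul_smul]
    exact ((hF.pow i.1).mul (hG.pow i.2)).mul (hS.pow (2 * M - i.1 - i.2))
  obtain ⟨a, ha, hZa⟩ := hrel (2 * M * D - N₀) (Fin (M + 1) × Fin (M + 1))
    (fun i => F ^ (i.1 : ℕ) * G ^ (i.2 : ℕ) * S ^ (2 * M - i.1 - i.2)) (fun i => by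
      rw [Nat.add_sub_cancel' hNM]
      exact hterm i) (by
      have h4 : 2 * M * D - N₀ + 1 ≤ 2 * M * D + 1 := by omega
      have h5 : (2 * M * D + 1) * c < (M + 1) * (M + 1) := by nlinarith [Nat.zero_le (D * c)]
      rw [Fintype.card_prod, Fintype.card_fin]
      exact lt_of_le_of_lt (Nat.mul_le_mul_right c h4) h5)
  have hhom : IsMultihomogeneous (∑ i : Fin (M + 1) × Fin (M + 1),
      C (a i) * (F ^ (i.1 : ℕ) * G ^ (i.2 : ℕ) * S ^ (2 * M - i.1 - i.2))) ((2 * M * D) • δ) :=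
    IsWeightedHomogeneous.sum _ _ _ fun i _ => (hterm i).C_mul _
  have hmem := (Frame.dehom_mem_ideal hZi hv hhom).2 hZa
  rw [← Ideal.Quotient.eq_zero_iff_mem] at hmem
  simp only [map_sum, map_mul, map_pow, hS1, one_pow, mul_one, hq, hr] at hmem
  let ex (i : Fin (M + 1) × Fin (M + 1)) : Fin 2 →₀ ℕ :=
    Finsupp.equivFunOnFinite.symm ![(i.1 : ℕ), (i.2 : ℕ)]
  have hex : Function.Injective ex := by
    intro i j hij
    have h6 := DFunLike.congr_fun hij 0
    have h7 := DFunLike.congr_fun hij 1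
    exact Prod.ext (Fin.ext h6) (Fin.ext h7)
  have hp := (algebraicIndependent_iff.1 hind) (∑ i, monomial (ex i) (a i)) (by
    rw [map_sum, ← hmem]
    refine Finset.sum_congr rfl fun i _ => ?_
    rw [aeval_monomial, Finsupp.prod_fintype _ _ (by simp), Fin.prod_univ_two, ← mul_assoc,
      mul_assoc]
    congr 1
    change _ = Ideal.Quotient.mk _ (v.dehom (algebraMap ℂ (CoordRing m) (a i)))
    rw [AlgHom.commutes]
    rfl)
  refine ha (funext fun i => ?_)
  have h8 := congrArg (coeff (ex i)) hp
  rw [coeff_sum, Finset.sum_eq_single i] at h8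
  · simpa using h8
  · intro j _ hj
    rw [coeff_monomial, if_neg fun h => hj (hex h)]
  · simp

/-- An irreducible closed set that two forms of the same multi-degree do not meet is at most a
curve. -/
theorem le_coheight_of_inter_eq_empty {m : ℕ} (Z : TopologicalSpace.IrreducibleCloseds (Segre m))
    {δ : Option (Fin m) → ℕ} (hδ : ∀ k, 1 ≤ δ k) {H₁ H₂ : CoordRing m}
    (h1 : IsMultihomogeneous H₁ δ) (h2 : IsMultihomogeneous H₂ δ)
    (hH : (Z : Set (Segre m)) ∩ zeroLocus H₁ ∩ zeroLocus H₂ = ∅) :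
    ((m + 2 : ℕ) : ℕ∞) ≤ Order.coheight Z := by
  obtain ⟨p, hp⟩ := Z.isIrreducible.nonempty
  obtain ⟨v, hv⟩ := Frame.exists_frame p
  have hvZ : v.Meets (Z : Set (Segre m)) := ⟨p, hp, hv⟩
  have hprime := Frame.isPrime_ideal Z.isIrreducible hvZ
  rw [Frame.coheight_eq_height_ideal Z hvZ]
  have h3 := card_le_height_add (v.ideal (Z : Set (Segre m))) 1
    (by exact_mod_cast trdeg_quotient_ideal_le_one Z.isClosed Z.isIrreducible hδ h1 h2 hH v hvZ)
  rw [Nat.card_eq_fintype_card, v.card_var] at h3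
  refine (ENat.add_le_add_iff_right (k := 1) (by simp)).1 ?_
  exact_mod_cast h3

/-! ### Components and dimension -/

lemma coheight_le_dim {m : ℕ} (Z : TopologicalSpace.IrreducibleCloseds (Segre m)) :
    Order.coheight Z ≤ ((m + 3 : ℕ) : ℕ∞) := by
  obtain ⟨p, hp⟩ := Z.isIrreducible.nonempty
  obtain ⟨v, hv⟩ := Frame.exists_frame p
  have hvZ : v.Meets (Z : Set (Segre m)) := ⟨p, hp, hv⟩
  have hprime := Frame.isPrime_ideal Z.isIrreducible hvZ
  rw [Frame.coheight_eq_height_ideal Z hvZ]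
  have h := Ideal.height_le_ringKrullDim_of_isPrime (I := v.ideal (Z : Set (Segre m)))
  rw [MvPolynomial.ringKrullDim_of_isNoetherianRing, ringKrullDim_eq_zero_of_field, zero_add,
    Nat.card_eq_fintype_card, v.card_var] at h
  exact WithBot.coe_le_coe.1 h

/-- Codimensions are bounded by `m + 3`, hence finite and strictly decreasing under enlargement; a
set of least codimension among those between `W` and `C` is maximal. -/
lemma exists_isComponent_ge {m : ℕ} {C : Set (Segre m)}
    (W : TopologicalSpace.IrreducibleCloseds (Segre m)) (hW : (W : Set (Segre m)) ⊆ C) :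
    ∃ Z, IsComponent C Z ∧ W ≤ Z := by
  obtain ⟨Z, ⟨hWZ, hZC⟩, hmin⟩ := (InvImage.wf (Order.coheight (α :=
    TopologicalSpace.IrreducibleCloseds (Segre m))) wellFounded_lt).has_min
    {Z | W ≤ Z ∧ (Z : Set (Segre m)) ⊆ C} ⟨W, le_rfl, hW⟩
  refine ⟨Z, ⟨hZC, fun Z' hZ' hle => ?_⟩, hWZ⟩
  by_contra hne
  have hlt : Z < Z' := lt_of_le_not_ge hle hne
  exact hmin Z' ⟨hWZ.trans hle, hZ'⟩ (Order.coheight_strictAnti hlt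
    ((coheight_le_dim Z').trans_lt (ENat.natCast_lt_top _)))

lemma exists_isComponent {m : ℕ} {C : Set (Segre m)} (hC : IsClosed C) (hne : C.Nonempty) :
    ∃ Z, IsComponent C Z := by
  obtain ⟨p, hp⟩ := hne
  obtain ⟨Z, hZ, -⟩ := exists_isComponent_ge (C := C)
    ⟨closure {p}, isIrreducible_singleton.closure, isClosed_closure⟩
    (closure_minimal (by simpa using hp) hC)
  exact ⟨Z, hZ⟩

/-- Krull's height theorem: the components of an intersection of divisors have at most the
expected codimension. -/
lemma IsComponent.coheight_le_card {m : ℕ} {ι : Type*} {S : Finset ι} {F : ι → CoordRing m}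
    {d : ι → Option (Fin m) → ℕ} (hF : ∀ i ∈ S, IsMultihomogeneous (F i) (d i))
    {Z : TopologicalSpace.IrreducibleCloseds (Segre m)}
    (hZ : IsComponent (⋂ i ∈ S, zeroLocus (F i)) Z) : Order.coheight Z ≤ S.card := by
  classical
  obtain ⟨p, hp⟩ := Z.isIrreducible.nonempty
  obtain ⟨v, hv⟩ := Frame.exists_frame p
  have hvZ : v.Meets (Z : Set (Segre m)) := ⟨p, hp, hv⟩
  have hprime := Frame.isPrime_ideal Z.isIrreducible hvZ
  rw [Frame.coheight_eq_height_ideal Z hvZ]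
  have hmin : v.ideal (Z : Set (Segre m)) ∈
      (Ideal.span (S.image fun i => v.dehom (F i) : Set (MvPolynomial v.Var ℂ))).minimalPrimes := by
    refine ⟨⟨hprime, ?_⟩, ?_⟩
    · rw [Ideal.span_le]
      intro q hq
      obtain ⟨i, hi, rfl⟩ := Finset.mem_image.1 (Finset.mem_coe.1 hq)
      exact (Frame.dehom_mem_ideal Z.isIrreducible hvZ (hF i hi)).2
        (hZ.1.trans (Set.biInter_subset_of_mem hi))
    -- A smaller prime over the equations is the ideal of an irreducible closed set between `Z` and
    -- the intersection, so it gives `Z` back by maximality.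
    · rintro Q ⟨hQ, hSQ⟩ hQZ
      obtain ⟨W, hvW, rfl⟩ := Frame.exists_ideal_eq Q
      have hZW := (Frame.ideal_le_ideal W.isClosed W.isIrreducible hvW Z.isIrreducible hvZ).1 hQZ
      refine (Frame.ideal_le_ideal Z.isClosed Z.isIrreducible hvZ W.isIrreducible hvW).2
        (hZ.2 (Set.subset_iInter₂ fun i hi => ?_) hZW)
      exact (Frame.dehom_mem_ideal W.isIrreducible hvW (hF i hi)).1
        (hSQ (Ideal.subset_span (Finset.mem_coe.2 (Finset.mem_image_of_mem _ hi))))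
  refine (Ideal.height_le_card_of_mem_minimalPrimes_span_finset hmin).trans ?_
  exact_mod_cast Finset.card_image_le

/-- An irreducible closed set of codimension less than `m + 3` is not minimal. -/
lemma exists_lt_of_coheight_lt {m : ℕ} (Z : TopologicalSpace.IrreducibleCloseds (Segre m))
    (hZ : Order.coheight Z < ((m + 3 : ℕ) : ℕ∞)) : ∃ W, W < Z := by
  obtain ⟨p, hp⟩ := Z.isIrreducible.nonempty
  obtain ⟨v, hv⟩ := Frame.exists_frame p
  have hvZ : v.Meets (Z : Set (Segre m)) := ⟨p, hp, hv⟩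
  have hprime := Frame.isPrime_ideal Z.isIrreducible hvZ
  rw [Frame.coheight_eq_height_ideal Z hvZ] at hZ
  obtain ⟨M, hM, hZM⟩ := Ideal.exists_le_maximal _ hprime.ne_top
  -- By Zariski's lemma the residue field of `M` is finite over `ℂ`; so `M` has height at least `m +
  -- 3`, more than the ideal of `Z`.
  have htr : Algebra.trdeg ℂ (MvPolynomial v.Var ℂ ⧸ M) ≤ (0 : ℕ) := by
    have : Algebra.IsAlgebraic ℂ (MvPolynomial v.Var ℂ ⧸ M) := by
      let _ := Ideal.Quotient.field M
      have := finite_of_finite_type_of_isJacobsonRing ℂ (MvPolynomial v.Var ℂ ⧸ M)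
      infer_instance
    simp [trdeg_eq_zero]
  have hMh := card_le_height_add M 0 htr
  rw [Nat.card_eq_fintype_card, v.card_var, Nat.cast_zero, add_zero] at hMh
  obtain ⟨W, hvW, rfl⟩ := Frame.exists_ideal_eq M
  refine ⟨W, lt_of_le_not_ge ?_ fun hle => ?_⟩
  · exact (Frame.ideal_le_ideal Z.isClosed Z.isIrreducible hvZ W.isIrreducible hvW).1 hZM
  · have h := (Frame.ideal_le_ideal W.isClosed W.isIrreducible hvW Z.isIrreducible hvZ).2 hle
    exact absurd (hMh.trans (Ideal.height_mono h)) (not_le.2 hZ)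

lemma isIrreducible_preimage_val {X : Type*} [TopologicalSpace X] {K W : Set X}
    (hW : IsIrreducible W) (hWK : W ⊆ K) : IsIrreducible ((↑) ⁻¹' W : Set K) := by
  refine ⟨?_, ?_⟩
  · obtain ⟨p, hp⟩ := hW.nonempty
    exact ⟨⟨p, hWK hp⟩, hp⟩
  · rintro U V hU hV ⟨p, hpW, hpU⟩ ⟨q, hqW, hqV⟩
    obtain ⟨U, hU', rfl⟩ := isOpen_induced_iff.1 hU
    obtain ⟨V, hV', rfl⟩ := isOpen_induced_iff.1 hV
    obtain ⟨r, hrW, hr⟩ := hW.isPreirreducible U V hU' hV' ⟨p, hpW, hpU⟩ ⟨q, hqW, hqV⟩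
    exact ⟨⟨r, hWK hrW⟩, hrW, hr⟩

/-- A closed set that contains an irreducible closed set of codimension `m + 2`, but none of
smaller codimension, has dimension one. -/
lemma topologicalKrullDim_eq_one {m : ℕ} {K : Set (Segre m)} (hK : IsClosed K)
    (h : ∀ W : TopologicalSpace.IrreducibleCloseds (Segre m), (W : Set (Segre m)) ⊆ K →
      ((m + 2 : ℕ) : ℕ∞) ≤ Order.coheight W)
    {Z : TopologicalSpace.IrreducibleCloseds (Segre m)} (hZK : (Z : Set (Segre m)) ⊆ K)
    (hZ : Order.coheight Z = ((m + 2 : ℕ) : ℕ∞)) : topologicalKrullDim K = 1 := by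
  apply le_antisymm
  · rw [topologicalKrullDim, Order.krullDim_le_one_iff]
    intro x
    by_contra! hx
    obtain ⟨y, hy⟩ := not_isMin_iff.1 hx.1
    obtain ⟨z, hz⟩ := not_isMax_iff.1 hx.2
    -- A chain `y < x < z` in `K` stays strict in the ambient space. As `z` has codimension at least
    -- `m + 2` there, `y` would have codimension at least `m + 4`, above the dimension.
    have hmono := TopologicalSpace.IrreducibleCloseds.map_strictMono_of_isInducing
      (Topology.IsInducing.subtypeVal (t := K))
    have h1 := Order.coheight_add_one_le (hmono hy)
    have h2 := Order.coheight_add_one_le (hmono hz)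
    have h3 := h (TopologicalSpace.IrreducibleCloseds.map _
      (Topology.IsInducing.subtypeVal (t := K)).continuous z)
      (closure_minimal (by rintro _ ⟨p, -, rfl⟩; exact p.2) hK)
    have h4 : ((m + 2 : ℕ) : ℕ∞) + 1 + 1 ≤ ((m + 3 : ℕ) : ℕ∞) :=
      ((add_le_add_left ((add_le_add_left h3 1).trans h2) 1).trans h1).trans (coheight_le_dim _)
    norm_cast at h4
    omega
  · rw [topologicalKrullDim, Order.one_le_krullDim_iff]
    obtain ⟨W, hWZ⟩ := exists_lt_of_coheight_lt Z (by rw [hZ]; norm_cast; omega)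
    have hWK : (W : Set (Segre m)) ⊆ K := (show (W : Set (Segre m)) ⊆ Z from hWZ.le).trans hZK
    refine ⟨⟨_, isIrreducible_preimage_val W.isIrreducible hWK,
      W.isClosed.preimage continuous_subtype_val⟩,
      ⟨_, isIrreducible_preimage_val Z.isIrreducible hZK,
      Z.isClosed.preimage continuous_subtype_val⟩, lt_of_le_not_ge ?_ fun hle => ?_⟩
    · exact Set.preimage_mono (f := ((↑) : K → Segre m)) (show (W : Set (Segre m)) ⊆ Z from hWZ.le)
    · refine not_le_of_gt hWZ fun p hp => ?_
      exact hle (show (⟨p, hZK hp⟩ : K) ∈ _ from hp)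

/-! ### The multi-degrees of the polynomials of a game -/

lemma isMultihomogeneous_sigma {m : ℕ} (k : Fin m) (j : Fin 2) :
    IsMultihomogeneous (sigma k j) (Pi.single (some k) 1) :=
  isWeightedHomogeneous_X ℂ (coordWeight m) (.inl (k, j))

lemma isMultihomogeneous_tau {m : ℕ} (a b : Fin 2) :
    IsMultihomogeneous (tau a b : CoordRing m) (Pi.single none 1) :=
  isWeightedHomogeneous_X ℂ (coordWeight m) (.inr (a, b))

lemma isMultihomogeneous_payoffPoly {m : ℕ} (X : Game m) (l a : Fin 2) :
    IsMultihomogeneous (payoffPoly X l a) 1 := by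
  refine IsWeightedHomogeneous.sum _ _ _ fun j _ => ?_
  have h := ((IsWeightedHomogeneous.prod Finset.univ _ _ fun k _ =>
    isMultihomogeneous_sigma k (j (.inl k))).C_mul ((X (.inr l) j : ℝ) : ℂ)).mul
      (isMultihomogeneous_tau (m := m) (j (.inr 0)) (j (.inr 1)))
  convert h using 1
  funext k
  rcases k with _ | k <;> simp [Finset.sum_apply, Pi.single_apply]

lemma isMultihomogeneous_poly {m : ℕ} (X : Game m) (i : Player m) :
    IsMultihomogeneous (poly X i) (multidegree i) := by
  have hdet {a b c d : CoordRing m} (ha : IsMultihomogeneous a (Pi.single none 1))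
      (hb : IsMultihomogeneous b 1) (hc : IsMultihomogeneous c (Pi.single none 1))
      (hd : IsMultihomogeneous d 1) (l : Fin 2) :
      IsMultihomogeneous (Matrix.det !![a, b; c, d]) (multidegree (.inr l)) := by
    rw [Matrix.det_fin_two_of]
    have e : (multidegree (.inr l) : Option (Fin m) → ℕ) = Pi.single none 1 + 1 := by
      funext k
      rcases k with _ | k <;> simp [multidegree]
    rw [e]
    exact (ha.mul hd).sub (add_comm (1 : Option (Fin m) → ℕ) (Pi.single none 1) ▸ hb.mul hc)
  match i with
  | .inl i =>
    refine IsWeightedHomogeneous.sum _ _ _ fun j _ => ?_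
    have h := ((IsWeightedHomogeneous.prod (Finset.univ.erase i) _ _ fun k _ =>
      isMultihomogeneous_sigma k (j (.inl k))).C_mul
        ((X (.inl i) (Function.update j (.inl i) 1) - X (.inl i) j : ℝ) : ℂ)).mul
      (isMultihomogeneous_tau (m := m) (j (.inr 0)) (j (.inr 1)))
    convert h using 1
    funext k
    rcases k with _ | k
    · simp [Finset.sum_apply, multidegree]
    · by_cases hk : k = i <;> simp [Finset.sum_apply, Pi.single_apply, multidegree, hk]
  | .inr 0 =>
    exact hdet ((isMultihomogeneous_tau _ _).add (isMultihomogeneous_tau _ _))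
      (isMultihomogeneous_payoffPoly _ _ _)
      ((isMultihomogeneous_tau _ _).add (isMultihomogeneous_tau _ _))
      (isMultihomogeneous_payoffPoly _ _ _) 0
  | .inr 1 =>
    exact hdet ((isMultihomogeneous_tau _ _).add (isMultihomogeneous_tau _ _))
      (isMultihomogeneous_payoffPoly _ _ _)
      ((isMultihomogeneous_tau _ _).add (isMultihomogeneous_tau _ _))
      (isMultihomogeneous_payoffPoly _ _ _) 1

/-- The zero locus of a polynomial of a game is that of two forms of a strictly positive
multi-degree. -/
lemma exists_zeroLocus_eq_inter {m : ℕ} (X : Game m) (i : Player m) :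
    ∃ (δ : Option (Fin m) → ℕ) (H₁ H₂ : CoordRing m), (∀ k, 1 ≤ δ k) ∧ IsMultihomogeneous H₁ δ ∧
      IsMultihomogeneous H₂ δ ∧ zeroLocus H₁ ∩ zeroLocus H₂ = zeroLocus (poly X i) := by
  have h := isMultihomogeneous_poly X i
  match i with
  | .inl i =>
    have e : (multidegree (.inl i) + Pi.single (some i) 1 : Option (Fin m) → ℕ) = 1 := by
      funext k
      rcases k with _ | k
      · simp [multidegree]
      · by_cases hk : k = i <;> simp [multidegree, hk]
    -- The form of player `i` has degree zero in the `i`-th factor. Multiplying by the two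
    -- coordinates of that factor, which have no common zero, makes the degree positive without
    -- changing the locus.
    refine ⟨1, poly X (.inl i) * sigma i 0, poly X (.inl i) * sigma i 1, fun _ => le_rfl,
      e ▸ h.mul (isMultihomogeneous_sigma i 0), e ▸ h.mul (isMultihomogeneous_sigma i 1), ?_⟩
    rw [zeroLocus_mul, zeroLocus_mul, ← Set.union_inter_distrib_left, Set.union_eq_left]
    rintro p ⟨h0, h1⟩
    refine absurd ?_ (p.line i).rep_nonzero
    funext j
    fin_cases j
    · simpa [zeroLocus, sigma, Segre.coord] using h0
    · simpa [zeroLocus, sigma, Segre.coord] using h1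
  | .inr l =>
    refine ⟨_, _, _, fun k => ?_, h, h, Set.inter_self _⟩
    rcases k with _ | k <;> simp [multidegree]

/-! ### Intersections of divisors of a game -/

/-- A component of the intersection so far has codimension at most `S.card < m + 2`. Were the next
divisor to miss it, `le_coheight_of_inter_eq_empty` would give at least `m + 2`. -/
lemma nonempty_iInter_zeroLocus_poly {m : ℕ} (X : Game m) (S : Finset (Player m)) :
    (⋂ i ∈ S, zeroLocus (poly X i)).Nonempty := by
  classical
  induction S using Finset.induction_on with
  | empty =>
    simp only [Finset.notMem_empty, Set.iInter_of_empty, Set.iInter_univ]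
    exact ⟨⟨fun _ => Classical.arbitrary _, Classical.arbitrary _⟩, trivial⟩
  | insert a S ha ih =>
    obtain ⟨Z, hZ⟩ := exists_isComponent
      (isClosed_biInter fun i _ => isClosed_zeroLocus (isMultihomogeneous_poly X i)) ih
    have h1 := hZ.coheight_le_card fun i _ => isMultihomogeneous_poly X i
    have hS : S.card < m + 2 := by
      have := Finset.card_lt_univ_of_notMem ha
      simpa using this
    obtain ⟨δ, H₁, H₂, hδ, hH₁, hH₂, hH⟩ := exists_zeroLocus_eq_inter X a
    rw [Finset.set_biInter_insert]
    by_contra hemp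
    rw [Set.not_nonempty_iff_eq_empty] at hemp
    have h2 := le_coheight_of_inter_eq_empty Z hδ hH₁ hH₂ (by
      rw [Set.inter_assoc, hH, Set.inter_comm]
      exact Set.subset_eq_empty (Set.inter_subset_inter_right _ hZ.1) hemp)
    have h3 := h2.trans h1
    norm_cast at h3
    omega

lemma spohnCI_eq_iInter {m : ℕ} (X : Game m) : spohnCI X = ⋂ i, zeroLocus (poly X i) := by
  ext p
  simp [spohnCI]

/-- If the Spohn CI variety does not meet the intersection of two forms of multi-degree
`(1, …, 1)`, then it is a curve and a complete intersection. -/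
theorem isCurve_and_isCompleteIntersection {m : ℕ} (X : Game m) {H₁ H₂ : CoordRing m}
    (h1 : IsMultihomogeneous H₁ 1) (h2 : IsMultihomogeneous H₂ 1)
    (hH : spohnCI X ∩ zeroLocus H₁ ∩ zeroLocus H₂ = ∅) :
    IsCurve (spohnCI X) ∧ IsCompleteIntersection (spohnCI X) (poly X) multidegree := by
  classical
  have hpoly := isMultihomogeneous_poly X
  have heq := spohnCI_eq_iInter X
  have heq' : spohnCI X = ⋂ i ∈ Finset.univ, zeroLocus (poly X i) := by simp [heq]
  have hne : (spohnCI X).Nonempty := heq' ▸ nonempty_iInter_zeroLocus_poly X Finset.univ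
  have hclosed : IsClosed (spohnCI X) :=
    heq ▸ isClosed_iInter fun i => isClosed_zeroLocus (hpoly i)
  have hge (W : TopologicalSpace.IrreducibleCloseds (Segre m))
      (hW : (W : Set (Segre m)) ⊆ spohnCI X) : ((m + 2 : ℕ) : ℕ∞) ≤ Order.coheight W :=
    le_coheight_of_inter_eq_empty W (fun _ => le_rfl) h1 h2 (Set.subset_eq_empty
      (Set.inter_subset_inter_left _ (Set.inter_subset_inter_left _ hW)) hH)
  have hcodim (Z : TopologicalSpace.IrreducibleCloseds (Segre m))
      (hZ : IsComponent (spohnCI X) Z) : Order.coheight Z = ((m + 2 : ℕ) : ℕ∞) := by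
    refine le_antisymm ?_ (hge Z hZ.1)
    rw [heq'] at hZ
    simpa using hZ.coheight_le_card fun i _ => hpoly i
  obtain ⟨Z, hZ⟩ := exists_isComponent hclosed hne
  refine ⟨⟨topologicalKrullDim_eq_one hclosed hge hZ.1 (hcodim Z hZ), fun Z hZ =>
    topologicalKrullDim_eq_one Z.isClosed (fun W hW => hge W (hW.trans hZ.1)) subset_rfl
      (hcodim Z hZ)⟩, ⟨fun i hi => ?_, hpoly, heq, hne, fun Z hZ => ?_⟩⟩
  -- A zero polynomial could be dropped from the equations, and Krull's theorem would then give
  -- codimension at most `n - 1`.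
  · have heq2 : spohnCI X = ⋂ j ∈ Finset.univ.erase i, zeroLocus (poly X j) := by
      rw [heq]
      refine subset_antisymm (fun p hp => ?_) fun p hp => ?_
      · exact Set.mem_iInter₂.2 fun j _ => Set.mem_iInter.1 hp j
      · refine Set.mem_iInter.2 fun j => ?_
        by_cases hj : j = i
        · rw [hj, hi]
          simp [zeroLocus]
        · exact Set.mem_iInter₂.1 hp j (by simp [hj])
    have hZ' := hZ
    rw [heq2] at hZ'
    have h3 := hZ'.coheight_le_card fun i _ => hpoly i
    rw [hcodim Z hZ, Finset.card_erase_of_mem (Finset.mem_univ _), Finset.card_univ] at h3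
    have h4 := Nat.cast_le.1 h3
    simp at h4
  · rw [hcodim Z hZ]
    simp

/-! ### Genericity -/

/-- Applying a real-linear functional to the coefficients commutes with evaluation at real points;
the real or the imaginary part does not kill the value at `x₀`. -/
lemma exists_real_polynomial {E : Type*} (P : MvPolynomial E ℂ) (x₀ : E → ℝ)
    (h : eval (fun e => (x₀ e : ℂ)) P ≠ 0) :
    ∃ G : MvPolynomial E ℝ, G ≠ 0 ∧
      ∀ x : E → ℝ, eval x G ≠ 0 → eval (fun e => (x e : ℂ)) P ≠ 0 := by
  have key (L : ℂ →ₗ[ℝ] ℝ) (x : E → ℝ) :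
      eval x (∑ μ ∈ P.support, monomial μ (L (coeff μ P))) =
        L (eval (fun e => (x e : ℂ)) P) := by
    rw [eval_eq _ P, map_sum, map_sum]
    refine Finset.sum_congr rfl fun μ _ => ?_
    have : coeff μ P * ∏ i ∈ μ.support, (x i : ℂ) ^ μ i =
        (∏ i ∈ μ.support, x i ^ μ i) • coeff μ P := by
      rw [Complex.real_smul, mul_comm]
      push_cast
      rfl
    rw [this, map_smul, eval_monomial, smul_eq_mul, mul_comm]
    rfl
  obtain ⟨L, hL⟩ : ∃ L : ℂ →ₗ[ℝ] ℝ, L (eval (fun e => (x₀ e : ℂ)) P) ≠ 0 := by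
    by_contra! hcon
    exact h (Complex.ext (hcon Complex.reLm) (hcon Complex.imLm))
  refine ⟨∑ μ ∈ P.support, monomial μ (L (coeff μ P)), fun h0 => hL ?_, fun x hx h0 => hx ?_⟩
  · rw [← key, h0, map_zero]
  · rw [key, h0, map_zero]

lemma payoffPoly_add {m : ℕ} (X Y : Game m) (l a : Fin 2) :
    payoffPoly (X + Y) l a = payoffPoly X l a + payoffPoly Y l a := by
  simp only [payoffPoly, ← Finset.sum_add_distrib]
  refine Finset.sum_congr rfl fun j _ => ?_
  simp only [Pi.add_apply, Complex.ofReal_add, map_add]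
  ring

lemma payoffPoly_smul {m : ℕ} (r : ℝ) (X : Game m) (l a : Fin 2) :
    payoffPoly (r • X) l a = C (r : ℂ) * payoffPoly X l a := by
  simp only [payoffPoly, Finset.mul_sum]
  refine Finset.sum_congr rfl fun j _ => ?_
  simp only [Pi.smul_apply, smul_eq_mul, Complex.ofReal_mul, map_mul]
  ring

lemma poly_add {m : ℕ} (X Y : Game m) (i : Player m) :
    poly (X + Y) i = poly X i + poly Y i := by
  match i with
  | .inl i =>
    simp only [poly, lonePoly, ← Finset.sum_add_distrib]
    refine Finset.sum_congr rfl fun j _ => ?_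
    simp only [Pi.add_apply, Complex.ofReal_add, Complex.ofReal_sub, map_add, map_sub]
    ring
  | .inr 0 =>
    simp only [poly, Matrix.det_fin_two_of, payoffPoly_add]
    ring
  | .inr 1 =>
    simp only [poly, Matrix.det_fin_two_of, payoffPoly_add]
    ring

lemma poly_smul {m : ℕ} (r : ℝ) (X : Game m) (i : Player m) :
    poly (r • X) i = C (r : ℂ) * poly X i := by
  match i with
  | .inl i =>
    simp only [poly, lonePoly, Finset.mul_sum]
    refine Finset.sum_congr rfl fun j _ => ?_
    simp only [Pi.smul_apply, smul_eq_mul, Complex.ofReal_mul, Complex.ofReal_sub, map_mul, map_sub]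
    ring
  | .inr 0 =>
    simp only [poly, Matrix.det_fin_two_of, payoffPoly_smul]
    ring
  | .inr 1 =>
    simp only [poly, Matrix.det_fin_two_of, payoffPoly_smul]
    ring

/-- The polynomials of a game depend linearly on the game. -/
noncomputable def polyLinearMap {m : ℕ} (i : Player m) : Game m →ₗ[ℝ] CoordRing m where
  toFun X := poly X i
  map_add' X Y := poly_add X Y i
  map_smul' r X := by
    rw [poly_smul, RingHom.id_apply, ← smul_eq_C_mul]
    rfl

lemma poly_eq_sum {m : ℕ} (i : Player m) : ∃ K : Player m × Profile m → CoordRing m,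
    ∀ X : Game m, poly X i = ∑ e, C ((X e.1 e.2 : ℝ) : ℂ) * K e := by
  classical
  refine ⟨fun e => poly (Pi.single e.1 (Pi.single e.2 1)) i, fun X => ?_⟩
  have hX : X = ∑ e : Player m × Profile m, X e.1 e.2 • Pi.single e.1 (Pi.single e.2 (1 : ℝ)) := by
    rw [Fintype.sum_prod_type]
    funext a b
    rw [Finset.sum_apply, Finset.sum_eq_single a, Finset.sum_apply, Finset.sum_apply,
      Finset.sum_eq_single b]
    · simp
    · intro c _ hc
      simp [hc.symm]
    · simp
    · intro c _ hc
      simp [Finset.sum_apply, hc.symm]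
    · simp
  change polyLinearMap i X = _
  conv_lhs => rw [hX]
  rw [map_sum]
  refine Finset.sum_congr rfl fun e _ => ?_
  rw [map_smul, ← smul_eq_C_mul]
  rfl

/-- The coefficients of combinations of the polynomials of a game with fixed multipliers are
polynomials in the payoffs. -/
lemma exists_eval_eq_coeff {m : ℕ} (c : Player m → CoordRing m) (B : CoordRing m)
    (μ : Coord m →₀ ℕ) : ∃ P : MvPolynomial (Player m × Profile m) ℂ, ∀ X : Game m,
      eval (fun e => ((X e.1 e.2 : ℝ) : ℂ)) P = coeff μ (∑ i, c i * poly X i + B) := by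
  choose K hK using fun i : Player m => poly_eq_sum i
  refine ⟨∑ i, ∑ e, MvPolynomial.X e * C (coeff μ (c i * K i e)) + C (coeff μ B), fun X => ?_⟩
  simp only [map_add, map_sum, map_mul, eval_X, eval_C, coeff_add, coeff_sum]
  congr 1
  refine Finset.sum_congr rfl fun i _ => ?_
  rw [hK, Finset.mul_sum, coeff_sum]
  refine Finset.sum_congr rfl fun e _ => ?_
  rw [mul_left_comm, coeff_C_mul]

/-- Homogeneous multipliers are needed because they are later kept fixed while the game varies, and
the combinations must remain forms of degree `e`. -/
lemma mem_span_forms {m : ℕ} {ι : Type*} [Fintype ι] {F : ι → CoordRing m}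
    {d : ι → Option (Fin m) → ℕ} (hF : ∀ i, IsMultihomogeneous (F i) (d i))
    {e : Option (Fin m) → ℕ} (he : ∀ i, d i ≤ e) {G : CoordRing m} (hG : IsMultihomogeneous G e)
    (hGF : G ∈ Ideal.span (Set.range F)) :
    ∃ c : ι → CoordRing m, (∀ i, IsMultihomogeneous (c i) (e - d i)) ∧ ∑ i, c i * F i = G := by
  obtain ⟨c, hc⟩ := Ideal.mem_span_range_iff_exists_fun.1 hGF
  refine ⟨fun i => weightedHomogeneousComponent (coordWeight m) (e - d i) (c i),
    fun i => weightedHomogeneousComponent_isWeightedHomogeneous _ _, ?_⟩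
  rw [← weightedHomogeneousComponent_eq_self hG, ← hc, map_sum]
  refine Finset.sum_congr rfl fun i _ => ?_
  rw [component_mul (hF i), if_pos (he i)]

lemma multidegree_le_two {m : ℕ} (i : Player m) (k : Option (Fin m)) : multidegree i k ≤ 2 := by
  rcases i with i | i <;> rcases k with _ | k <;> simp only [multidegree]
  · omega
  · split_ifs <;> omega
  · omega
  · omega

/-- The games whose Spohn CI variety avoids the intersection of two given forms of multi-degree
`(1, …, 1)` are generic as soon as there is one of them. -/
theorem generic_of_exists {m : ℕ} (X₀ : Game m) {H₁ H₂ : CoordRing m}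
    (h1 : IsMultihomogeneous H₁ 1) (h2 : IsMultihomogeneous H₂ 1)
    (hH : spohnCI X₀ ∩ zeroLocus H₁ ∩ zeroLocus H₂ = ∅) :
    Generic fun X : Game m => spohnCI X ∩ zeroLocus H₁ ∩ zeroLocus H₂ = ∅ := by
  classical
  let F (X : Game m) : Player m ⊕ Fin 2 → CoordRing m := Sum.elim (poly X) ![H₁, H₂]
  let d : Player m ⊕ Fin 2 → Option (Fin m) → ℕ := Sum.elim multidegree 1
  have hF (X : Game m) (i) : IsMultihomogeneous (F X i) (d i) := by
    rcases i with i | i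
    · exact isMultihomogeneous_poly X i
    · fin_cases i
      · exact h1
      · exact h2
  have hrel : ∀ x, Relevant x → ∃ G ∈ Ideal.span (Set.range (F X₀)), eval x G ≠ 0 := by
    intro x hx
    by_contra! hcon
    have hz (i) : ofCoord x hx ∈ zeroLocus (F X₀ i) :=
      (ofCoord_mem_zeroLocus (hF X₀ i) x hx).2 (hcon _ (Ideal.subset_span ⟨i, rfl⟩))
    have : ofCoord x hx ∈ spohnCI X₀ ∩ zeroLocus H₁ ∩ zeroLocus H₂ :=
      ⟨⟨fun i => hz (.inl i), hz (.inr 0)⟩, hz (.inr 1)⟩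
    simp [hH] at this
  obtain ⟨n, hn⟩ := exists_forall_mem hrel
  -- The summand `n` is for the Nullstellensatz; the summand `2` makes `e` dominate every `d i`, so
  -- that the subtractions `e - d i` are not truncated.
  set e : Option (Fin m) → ℕ := (n + 2) • 1 with he
  have hek (k) : e k = n + 2 := by simp [he]
  have hde (i) : d i ≤ e := by
    intro k
    rw [hek]
    rcases i with i | i
    · exact (multidegree_le_two i k).trans (by omega)
    · change 1 ≤ n + 2
      omega
  let J : Type := {μ : Coord m →₀ ℕ // Finsupp.weight (coordWeight m) μ = e}
  have : Fintype J := (finite_weight_eq e).fintype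
  have hmono (a : J) : IsMultihomogeneous (monomial a.1 (1 : ℂ)) e :=
    isWeightedHomogeneous_monomial _ _ _ a.2
  -- The multipliers express each monomial of degree `e` for the game `X₀` and are then used for all
  -- `X`. The coefficient matrix of the resulting forms is the identity at `X₀`.
  choose c hc hcsum using fun a : J => mem_span_forms (hF X₀) hde (hmono a)
    (hn e (fun k => by rw [hek]; omega) _ (hmono a))
  let Φ (X : Game m) (a : J) : CoordRing m := ∑ i, c a i * F X i
  have hΦ (X : Game m) (a : J) : IsMultihomogeneous (Φ X a) e :=
    IsWeightedHomogeneous.sum _ _ _ fun i _ => by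
      have h := (hc a i).mul (hF X i)
      rwa [tsub_add_cancel_of_le (hde i)] at h
  choose T hT using fun (a b : J) => exists_eval_eq_coeff (fun i => c a (.inl i))
    (∑ i, c a (.inr i) * ![H₁, H₂] i) b.1
  have hTΦ (X : Game m) (a b : J) :
      eval (fun e => ((X e.1 e.2 : ℝ) : ℂ)) (T a b) = coeff b.1 (Φ X a) := by
    rw [hT]
    exact congrArg _ (Fintype.sum_sum_type (fun i => c a i * F X i)).symm
  have hdet (X : Game m) : eval (fun e => ((X e.1 e.2 : ℝ) : ℂ)) (Matrix.det (Matrix.of T)) =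
      Matrix.det (Matrix.of fun a b => coeff b.1 (Φ X a)) := by
    rw [RingHom.map_det]
    congr 1
    ext a b
    exact hTΦ X a b
  obtain ⟨G, hG, hGX⟩ := exists_real_polynomial (Matrix.det (Matrix.of T))
    (fun e => X₀ e.1 e.2) (by
      rw [hdet X₀]
      have : (Matrix.of fun a b : J => coeff b.1 (Φ X₀ a)) = 1 := by
        ext a b
        rw [Matrix.of_apply, show Φ X₀ a = monomial a.1 1 from hcsum a, coeff_monomial,
          Matrix.one_apply]
        exact if_congr Subtype.ext_iff.symm rfl rfl
      rw [this, Matrix.det_one]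
      exact one_ne_zero)
  refine ⟨G, hG, fun X hX => ?_⟩
  have hne := hGX _ hX
  rw [hdet X] at hne
  refine Set.eq_empty_iff_forall_notMem.2 fun p hp => ?_
  have hpF (i) : eval p.coord (F X i) = 0 := by
    rcases i with i | i
    · exact hp.1.1 i
    · fin_cases i
      · exact hp.1.2
      · exact hp.2
  -- At a common zero the values of the monomials of degree `e` form a kernel vector. An invertible
  -- matrix forces them all to vanish, yet `denom ^ (n + 2)` of a chart around `p` is one of them.
  have hvec : (Matrix.of fun a b : J => coeff b.1 (Φ X a)).mulVec
      (fun b => eval p.coord (monomial b.1 1)) = 0 := by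
    funext a
    have h0 : eval p.coord (Φ X a) = 0 := by simp [Φ, hpF]
    rw [Pi.zero_apply, ← h0, eval_eq]
    simp only [Matrix.mulVec, dotProduct, Matrix.of_apply, eval_monomial, one_mul]
    symm
    refine Finset.sum_bij_ne_zero (fun μ hμ _ => (⟨μ, hΦ X a (mem_support_iff.1 hμ)⟩ : J))
      (fun _ _ _ => Finset.mem_univ _) (fun μ _ _ ν _ _ h => congrArg Subtype.val h)
      (fun b _ hb => ⟨b.1, mem_support_iff.2 (left_ne_zero_of_mul hb), hb, rfl⟩) fun _ _ _ => rfl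
  have hzero := Matrix.eq_zero_of_mulVec_eq_zero hne hvec
  obtain ⟨v, hv⟩ := Frame.exists_frame p
  have hpow : v.denom ^ (n + 2) =
      monomial ((n + 2) • ∑ k, Finsupp.single (v k).1 1) (1 : ℂ) := by
    rw [v.denom_eq_monomial, monomial_pow, one_pow]
  have hw : Finsupp.weight (coordWeight m) ((n + 2) • ∑ k, Finsupp.single (v k).1 1) = e := by
    have h := v.isMultihomogeneous_denom.pow (n + 2)
    rw [hpow] at h
    exact h (by simp)
  have h3 := congrFun hzero ⟨_, hw⟩
  simp only [← hpow, map_pow, Pi.zero_apply] at h3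
  exact hv (pow_eq_zero_iff (by omega) |>.1 h3)

/-! ### A game whose divisors are products of linear forms -/

/-- This is distributivity; it factors the polynomials of a game whose payoffs are products. -/
lemma sum_profile {m : ℕ} (g : Fin m → Fin 2 → ℂ) (h : Fin 2 → Fin 2 → ℂ) :
    ∑ j : Profile m, (∏ k, g k (j (.inl k))) * h (j (.inr 0)) (j (.inr 1)) =
      (∏ k, ∑ a, g k a) * ∑ a, ∑ b, h a b := by
  have e1 : ∏ k, ∑ a, g k a = ∑ f : Fin m → Fin 2, ∏ k, g k (f k) := by
    rw [Finset.prod_univ_sum]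
    simp
  have e2 : ∑ a, ∑ b, h a b = ∑ f : Fin 2 → Fin 2, h (f 0) (f 1) := by
    rw [← Fintype.sum_prod_type', ← (finTwoArrowEquiv (Fin 2)).sum_comp]
    rfl
  rw [e1, e2, Finset.sum_mul_sum, ← Fintype.sum_prod_type',
    ← (Equiv.sumArrowEquivProdArrow (Fin m) (Fin 2) (Fin 2)).sum_comp]
  rfl

/-- The coefficients of the linear form on `ℙ¹` with root `r`. -/
def rootCoeff (r : ℕ) (a : Fin 2) : ℝ := if a = 0 then -r else 1

/-- The coefficients of the linear form on `ℙ³` that evaluates a cubic polynomial at `-t`. -/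
def cubicCoeff (t : ℕ) (a b : Fin 2) : ℝ := (-t) ^ (2 * (a : ℕ) + b)

/-- The value of the linear form on the `k`-th factor `ℙ¹` with root `r`. -/
def rootValue {m : ℕ} (x : Coord m → ℂ) (r : ℕ) (k : Fin m) : ℂ :=
  ∑ a, (rootCoeff r a : ℂ) * x (.inl (k, a))

/-- The value at `-t` of the cubic polynomial with coefficients `τ`. -/
def cubicValue {m : ℕ} (x : Coord m → ℂ) (t : ℕ) : ℂ :=
  ∑ a, ∑ b, (cubicCoeff t a b : ℂ) * x (.inr (a, b))

/-- The numbers that distinguish the players and the two additional divisors. -/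
noncomputable def label {m : ℕ} (d : Player m ⊕ Fin 2) : ℕ := Fintype.equivFin _ d

lemma label_injective {m : ℕ} : Function.Injective (label (m := m)) :=
  Fin.val_injective.comp (Fintype.equivFin _).injective

/-- A game whose polynomials are products of linear forms. -/
noncomputable def splitGame (m : ℕ) : Game m
  | .inl i, j => if j (.inl i) = 1 then
      (∏ k ∈ Finset.univ.erase i, rootCoeff (label (m := m) (.inl (.inl i))) (j (.inl k))) *
        cubicCoeff (10 + label (m := m) (.inl (.inl i))) (j (.inr 0)) (j (.inr 1)) else 0
  | .inr l, j => (∏ k : Fin m, rootCoeff (label (m := m) (.inl (.inr l))) (j (.inl k))) *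
      -- Only the second strategy pays, so each determinant reduces to a product of linear forms.
      -- The factor is `τ₂₂` for `l = 0` and `τ₁₂` for `l = 1`, so that the two quadrics share no
      -- plane.
      if j (.inr 0) = 1 - l ∧ j (.inr 1) = 1 then 1 else 0

/-- A form of multi-degree `(1, …, 1)` that is a product of linear forms. -/
noncomputable def splitForm (m : ℕ) (l : Fin 2) : CoordRing m :=
  (∏ k : Fin m, ∑ a, C (rootCoeff (label (m := m) (.inr l)) a : ℂ) * sigma k a) *
    ∑ a, ∑ b, C (cubicCoeff (10 + label (m := m) (.inr l)) a b : ℂ) * tau a b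

lemma isMultihomogeneous_splitForm (m : ℕ) (l : Fin 2) : IsMultihomogeneous (splitForm m l) 1 := by
  have h := (IsWeightedHomogeneous.prod Finset.univ _ _ fun (k : Fin m) _ =>
    IsWeightedHomogeneous.sum Finset.univ _ _ fun a _ =>
      (isMultihomogeneous_sigma k a).C_mul (rootCoeff (label (m := m) (.inr l)) a : ℂ)).mul
    (IsWeightedHomogeneous.sum Finset.univ _ _ fun a _ =>
      IsWeightedHomogeneous.sum Finset.univ _ _ fun b _ =>
        (isMultihomogeneous_tau (m := m) a b).C_mul
          (cubicCoeff (10 + label (m := m) (.inr l)) a b : ℂ))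
  have e : (1 : Option (Fin m) → ℕ) = ∑ k, Pi.single (some k) 1 + Pi.single none 1 := by
    funext k
    rcases k with _ | k <;> simp [Finset.sum_apply, Pi.single_apply]
  rw [e]
  exact h

lemma eval_splitForm {m : ℕ} (x : Coord m → ℂ) (l : Fin 2) :
    eval x (splitForm m l) = (∏ k, rootValue x (label (m := m) (.inr l)) k) *
      cubicValue x (10 + label (m := m) (.inr l)) := by
  simp [splitForm, rootValue, cubicValue, sigma, tau]

lemma eval_poly_splitGame_inl {m : ℕ} (x : Coord m → ℂ) (i : Fin m) :
    eval x (poly (splitGame m) (.inl i)) =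
      (∏ k ∈ Finset.univ.erase i, rootValue x (label (m := m) (.inl (.inl i))) k) *
        cubicValue x (10 + label (m := m) (.inl (.inl i))) := by
  set r := label (m := m) (.inl (.inl i)) with hr
  -- In position `i` the indicator of the first strategy turns the sum over restricted profiles into
  -- a sum over all of them.
  let g (k : Fin m) (a : Fin 2) : ℂ :=
    if k = i then (if a = 0 then 1 else 0) else rootCoeff r a * x (.inl (k, a))
  have h1 := sum_profile g fun a b => (cubicCoeff (10 + r) a b : ℂ) * x (.inr (a, b))
  have h2 : ∏ k, ∑ a, g k a = ∏ k ∈ Finset.univ.erase i, rootValue x r k := by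
    rw [← Finset.mul_prod_erase _ _ (Finset.mem_univ i)]
    have : ∑ a, g i a = 1 := by simp [g]
    rw [this, one_mul]
    refine Finset.prod_congr rfl fun k hk => ?_
    simp [g, Finset.ne_of_mem_erase hk, rootValue]
  rw [h2] at h1
  refine Eq.trans ?_ h1
  simp only [poly, lonePoly, map_sum]
  rw [Finset.sum_filter]
  refine Finset.sum_congr rfl fun j _ => ?_
  rw [← Finset.mul_prod_erase _ _ (Finset.mem_univ i)]
  have h3 : ∏ k ∈ Finset.univ.erase i, g k (j (.inl k)) =
      (∏ k ∈ Finset.univ.erase i, (rootCoeff r (j (.inl k)) : ℂ)) *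
        ∏ k ∈ Finset.univ.erase i, x (.inl (k, j (.inl k))) := by
    rw [← Finset.prod_mul_distrib]
    refine Finset.prod_congr rfl fun k hk => ?_
    simp [g, Finset.ne_of_mem_erase hk]
  rw [h3]
  split_ifs with hj
  · have h4 : splitGame m (.inl i) (Function.update j (.inl i) 1) - splitGame m (.inl i) j =
        (∏ k ∈ Finset.univ.erase i, rootCoeff r (j (.inl k))) *
          cubicCoeff (10 + r) (j (.inr 0)) (j (.inr 1)) := by
      simp only [splitGame, Function.update_self, hj, if_true, zero_ne_one, if_false, sub_zero]
      rw [Function.update_of_ne (by simp), Function.update_of_ne (by simp)]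
      congr 1
      refine Finset.prod_congr rfl fun k hk => ?_
      rw [Function.update_of_ne (by simpa using Finset.ne_of_mem_erase hk)]
    rw [h4]
    simp [g, hj, sigma, tau]
    ring
  · simp [g, hj]

lemma eval_payoffPoly_splitGame {m : ℕ} (x : Coord m → ℂ) (l a : Fin 2) :
    eval x (payoffPoly (splitGame m) l a) =
      (∏ k, rootValue x (label (m := m) (.inl (.inr l))) k) *
        if a = 1 then x (.inr (1 - l, 1)) else 0 := by
  set r := label (m := m) (.inl (.inr l)) with hr
  have h1 := sum_profile (fun k b => (rootCoeff r b : ℂ) * x (.inl (k, b)))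
    fun b c => if ![b, c] l = a then (if b = 1 - l ∧ c = 1 then 1 else 0) * x (.inr (b, c)) else 0
  have h2 : (∑ b, ∑ c, if ![b, c] l = a then
      (if b = 1 - l ∧ c = 1 then 1 else 0) * x (.inr (b, c)) else 0) =
        if a = 1 then x (.inr (1 - l, 1)) else 0 := by
    fin_cases l <;> fin_cases a <;> simp
  rw [h2] at h1
  refine Eq.trans ?_ h1
  simp only [payoffPoly, map_sum]
  rw [Finset.sum_filter]
  refine Finset.sum_congr rfl fun j _ => ?_
  have h3 : ![j (.inr 0), j (.inr 1)] l = j (.inr l) := by fin_cases l <;> rfl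
  rw [h3]
  split_ifs with hj h4
  · simp [splitGame, sigma, tau, h4, Finset.prod_mul_distrib, hr]
  · simp [splitGame, h4]
  · simp

/-- The quadratic form on `ℙ³` in the polynomials of the split game for the last two players. -/
def quadricValue {m : ℕ} (x : Coord m → ℂ) (l : Fin 2) : ℂ :=
  (x (.inr (0, 0)) + x (.inr (l, 1 - l))) * x (.inr (1 - l, 1))

lemma eval_poly_splitGame_inr {m : ℕ} (x : Coord m → ℂ) (l : Fin 2) :
    eval x (poly (splitGame m) (.inr l)) =
      (∏ k, rootValue x (label (m := m) (.inl (.inr l))) k) * quadricValue x l := by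
  fin_cases l <;>
  · simp [poly, Matrix.det_fin_two_of, eval_payoffPoly_splitGame, quadricValue, tau]
    ring

lemma eq_zero_of_rootValue {m : ℕ} {x : Coord m → ℂ} {k : Fin m} {r s : ℕ} (hrs : r ≠ s)
    (hr : rootValue x r k = 0) (hs : rootValue x s k = 0) (a : Fin 2) : x (.inl (k, a)) = 0 := by
  simp [rootValue, rootCoeff] at hr hs
  have h0 : x (.inl (k, 0)) = 0 := by
    have : ((r : ℂ) - s) * x (.inl (k, 0)) = 0 := by linear_combination hs - hr
    exact (mul_eq_zero.1 this).resolve_left (sub_ne_zero.2 (by exact_mod_cast hrs))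
  fin_cases a
  · exact h0
  · simpa [h0] using hr

/-- A cubic polynomial with roots `-s` and `-t` is `(X ^ 2 + (s + t) X + s t) (α X + β)`. -/
lemma exists_eq_of_cubicValue {m : ℕ} {x : Coord m → ℂ} {s t : ℕ} (hst : s ≠ t)
    (hs : cubicValue x s = 0) (ht : cubicValue x t = 0) :
    ∃ α β : ℂ, x (.inr (1, 1)) = α ∧ x (.inr (1, 0)) = (s + t) * α + β ∧
      x (.inr (0, 1)) = s * t * α + (s + t) * β ∧ x (.inr (0, 0)) = s * t * β := by
  simp [cubicValue, cubicCoeff] at hs ht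
  have hne : (s : ℂ) - t ≠ 0 := sub_ne_zero.2 (by exact_mod_cast hst)
  have h1 : x (.inr (0, 1)) = (s + t) * x (.inr (1, 0)) -
      (s ^ 2 + s * t + t ^ 2) * x (.inr (1, 1)) := by
    refine mul_left_cancel₀ hne ?_
    linear_combination ht - hs
  refine ⟨_, x (.inr (1, 0)) - (s + t) * x (.inr (1, 1)), rfl, by ring, by rw [h1]; ring, ?_⟩
  rw [h1] at hs
  linear_combination hs

/-- The linear and quadratic forms on `ℙ³` in the split game are in general position. -/
lemma eq_zero_of_cubicValue {m : ℕ} {x : Coord m → ℂ} {S : Finset ℕ}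
    (hS : ∀ t ∈ S, 10 ≤ t ∧ cubicValue x t = 0)
    (hcard : 4 ≤ S.card + (if quadricValue x 0 = 0 then 1 else 0) +
      (if quadricValue x 1 = 0 then 1 else 0)) (c : Fin 2 × Fin 2) : x (.inr c) = 0 := by
  have hS2 : 1 < S.card := by split_ifs at hcard <;> omega
  obtain ⟨s, hs, t, ht, hst⟩ := Finset.one_lt_card.1 hS2
  obtain ⟨hs10, hs0⟩ := hS s hs
  obtain ⟨ht10, ht0⟩ := hS t ht
  obtain ⟨α, β, h11, h10, h01, h00⟩ := exists_eq_of_cubicValue hst hs0 ht0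
  have hq0 : quadricValue x 0 = (s * t * β + (s * t * α + (s + t) * β)) * α := by
    simp [quadricValue, h11, h01, h00]
  have hq1 : quadricValue x 1 =
      (s * t * β + ((s + t) * α + β)) * (s * t * α + (s + t) * β) := by
    simp [quadricValue, h10, h01, h00]
  suffices h : α = 0 ∧ β = 0 by
    obtain ⟨a, b⟩ := c
    fin_cases a <;> fin_cases b <;> simp [h00, h01, h10, h11, h]
  have hthird (u : ℕ) (hu : u ∈ S) (hus : u ≠ s) (hut : u ≠ t) : β = u * α := by
    have hu0 := (hS u hu).2
    simp [cubicValue, cubicCoeff, h00, h01, h10, h11] at hu0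
    have h1 : ((s : ℂ) - u) * (t - u) * (β - u * α) = 0 := by linear_combination hu0
    have h2 : (s : ℂ) - u ≠ 0 := sub_ne_zero.2 (by exact_mod_cast hus.symm)
    have h3 : (t : ℂ) - u ≠ 0 := sub_ne_zero.2 (by exact_mod_cast hut.symm)
    exact sub_eq_zero.1 ((mul_eq_zero.1 h1).resolve_left (mul_ne_zero h2 h3))
  by_cases hu : ∃ u ∈ S, u ≠ s ∧ u ≠ t
  · obtain ⟨u, hu, hus, hut⟩ := hu
    have hβ := hthird u hu hus hut
    suffices h : α = 0 from ⟨h, by rw [hβ, h, mul_zero]⟩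
    by_cases hw : ∃ w ∈ S, w ≠ s ∧ w ≠ t ∧ w ≠ u
    · obtain ⟨w, hw, hws, hwt, hwu⟩ := hw
      have h1 : ((u : ℂ) - w) * α = 0 := by
        linear_combination hthird w hw hws hwt - hβ
      exact (mul_eq_zero.1 h1).resolve_left (sub_ne_zero.2 (by exact_mod_cast hwu.symm))
    · have hS3 : S.card ≤ 3 := by
        refine (Finset.card_le_card (t := {s, t, u}) fun w hwS => ?_).trans Finset.card_le_three
        by_contra hcon
        simp only [Finset.mem_insert, Finset.mem_singleton, not_or] at hcon
        exact hw ⟨w, hwS, hcon⟩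
      have hor : quadricValue x 0 = 0 ∨ quadricValue x 1 = 0 := by
        by_contra! hcon
        simp only [hcon.1, hcon.2, if_false] at hcard
        omega
      -- With three roots `-s`, `-t`, `-u` the cubic is `α (X + s) (X + t) (X + u)`. Evaluating at
      -- negative numbers makes every coefficient a positive multiple of `α`, so no linear factor of
      -- a quadric can cancel.
      have hpos (n : ℕ) (hn : 0 < n) (h : (n : ℂ) * α = 0) : α = 0 :=
        (mul_eq_zero.1 h).resolve_left (by exact_mod_cast hn.ne')
      rw [hq0, hq1, hβ] at hor
      rcases hor with h | h <;> rcases mul_eq_zero.1 h with h | h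
      · refine hpos (s * t * u + s * t + (s + t) * u) (by positivity) ?_
        push_cast
        linear_combination h
      · exact h
      · refine hpos (s * t * u + (s + t) + u) (by positivity) ?_
        push_cast
        linear_combination h
      · refine hpos (s * t + (s + t) * u) (by positivity) ?_
        push_cast
        linear_combination h
  · have hSle : S.card ≤ 2 := by
      refine (Finset.card_le_card (t := {s, t}) fun w hwS => ?_).trans Finset.card_le_two
      by_contra hcon
      simp only [Finset.mem_insert, Finset.mem_singleton, not_or] at hcon
      exact hu ⟨w, hwS, hcon⟩
    have h0 : quadricValue x 0 = 0 := by
      by_contra hcon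
      simp only [hcon, if_false] at hcard
      split_ifs at hcard <;> omega
    have h1 : quadricValue x 1 = 0 := by
      by_contra hcon
      simp only [hcon, if_false] at hcard
      split_ifs at hcard
      omega
    rw [hq0] at h0
    rw [hq1] at h1
    have hs' : (s : ℂ) ≠ 0 := by exact_mod_cast (by omega : s ≠ 0)
    have ht' : (t : ℂ) ≠ 0 := by exact_mod_cast (by omega : t ≠ 0)
    have he' : (s : ℂ) + t ≠ 0 := by exact_mod_cast (by omega : s + t ≠ 0)
    have hg' : (s : ℂ) * t + 1 ≠ 0 := by exact_mod_cast (by omega : s * t + 1 ≠ 0)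
    rcases mul_eq_zero.1 h0 with h0 | h0
    · have hα (hβ : β = 0) : α = 0 := by
        rw [hβ] at h0
        simpa [hs', ht'] using h0
      suffices h : β = 0 from ⟨hα h, h⟩
      rcases mul_eq_zero.1 h1 with h1 | h1
      -- Eliminating `α` leaves this multiple of `β`. Its coefficient is nonzero because `s` and `t`
      -- are at least `10`, which is the purpose of the offset in the cubic labels.
      · have h2 : (((s * t * (s * t + 1) : ℕ) : ℂ) - ((s + t) * (s * t + (s + t)) : ℕ)) * β = 0 := by
          push_cast
          linear_combination (s * t : ℂ) * h1 - (s + t : ℂ) * h0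
        refine (mul_eq_zero.1 h2).resolve_left (sub_ne_zero.2 ?_)
        have h3 : 5 * (s + t) ≤ s * t := by nlinarith
        have h4 : (s + t) * (s * t + (s + t)) < s * t * (s * t + 1) := by nlinarith
        exact_mod_cast h4.ne'
      · have h2 : (s : ℂ) * t * β = 0 := by linear_combination h0 - h1
        simpa [hs', ht'] using h2
    · subst h0
      refine ⟨rfl, ?_⟩
      have h2 : ((s : ℂ) * t + 1) * (s + t) * (β * β) = 0 := by linear_combination h1
      simpa [hg', he'] using h2

/-- The Spohn CI variety of the split game avoids the intersection of the split forms. -/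
lemma spohnCI_splitGame_inter (m : ℕ) :
    spohnCI (splitGame m) ∩ zeroLocus (splitForm m 0) ∩ zeroLocus (splitForm m 1) = ∅ := by
  classical
  refine Set.eq_empty_iff_forall_notMem.2 fun p ⟨⟨hC, hp0⟩, hp1⟩ => ?_
  set x := p.coord with hx
  -- `q d` is the `ℙ³` factor of the product attached to `d`; where it is nonzero, a linear form on
  -- some `ℙ¹` must vanish.
  let q : Player m ⊕ Fin 2 → ℂ := fun d => match d with
    | .inl (.inr l) => quadricValue x l
    | d => cubicValue x (10 + label d)
  have hd (d : Player m ⊕ Fin 2) (hqd : q d ≠ 0) : ∃ k, rootValue x (label d) k = 0 := by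
    match d with
    | .inl (.inl i) =>
      have h : eval x _ = 0 := hC (.inl i)
      rw [eval_poly_splitGame_inl] at h
      obtain ⟨k, -, hk⟩ := Finset.prod_eq_zero_iff.1 ((mul_eq_zero.1 h).resolve_right hqd)
      exact ⟨k, hk⟩
    | .inl (.inr l) =>
      have h : eval x _ = 0 := hC (.inr l)
      rw [eval_poly_splitGame_inr] at h
      obtain ⟨k, -, hk⟩ := Finset.prod_eq_zero_iff.1 ((mul_eq_zero.1 h).resolve_right hqd)
      exact ⟨k, hk⟩
    | .inr l =>
      have h : eval x (splitForm m l) = 0 := by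
        fin_cases l
        · exact hp0
        · exact hp1
      rw [eval_splitForm] at h
      obtain ⟨k, -, hk⟩ := Finset.prod_eq_zero_iff.1 ((mul_eq_zero.1 h).resolve_right hqd)
      exact ⟨k, hk⟩
  choose κ hκ using hd
  have hcard : ({d | q d ≠ 0} : Finset (Player m ⊕ Fin 2)).card ≤ m := by
    -- Two labels sharing a line would give two distinct roots at the same point of `ℙ¹`.
    have hinj : Function.Injective fun d : {d // q d ≠ 0} => κ d.1 d.2 := by
      intro d e hde
      by_contra hne
      obtain ⟨c, hc, hcne⟩ := p.relevant_coord (some (κ d.1 d.2))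
      rcases c with ⟨k, a⟩ | c
      · obtain rfl : k = κ d.1 d.2 := by simpa [factor] using hc
        refine hcne (eq_zero_of_rootValue (label_injective.ne fun h => hne (Subtype.ext h))
          (hκ d.1 d.2) ?_ a)
        rw [show κ d.1 d.2 = κ e.1 e.2 from hde]
        exact hκ e.1 e.2
      · simp [factor] at hc
    have h := Fintype.card_le_of_injective _ hinj
    rwa [Fintype.card_fin, Fintype.card_subtype] at h
  have hcard' : 4 ≤ ({d | q d = 0} : Finset (Player m ⊕ Fin 2)).card := by
    have h := Finset.card_filter_add_card_filter_not (s := (Finset.univ : Finset (Player m ⊕ Fin 2)))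
      (fun d => q d = 0)
    rw [Finset.card_univ] at h
    simp only [Fintype.card_sum, Fintype.card_fin] at h
    change _ + ({d | q d ≠ 0} : Finset (Player m ⊕ Fin 2)).card = _ at h
    omega
  let T : Finset (Player m ⊕ Fin 2) := {d | q d = 0 ∧ ∀ l, d ≠ .inl (.inr l)}
  let S : Finset ℕ := T.image fun d => 10 + label d
  have hS : ∀ t ∈ S, 10 ≤ t ∧ cubicValue x t = 0 := by
    intro t ht
    obtain ⟨d, hd, rfl⟩ := Finset.mem_image.1 ht
    obtain ⟨-, hq, hne⟩ := Finset.mem_filter.1 hd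
    refine ⟨Nat.le_add_right _ _, ?_⟩
    match d with
    | .inl (.inl i) => exact hq
    | .inl (.inr l) => exact absurd rfl (hne l)
    | .inr l => exact hq
  have hScard : S.card = T.card :=
    Finset.card_image_of_injective _ fun d e h => label_injective (Nat.add_left_cancel h)
  have hsplit : ({d | q d = 0} : Finset (Player m ⊕ Fin 2)).card ≤ S.card +
      (if quadricValue x 0 = 0 then 1 else 0) + (if quadricValue x 1 = 0 then 1 else 0) := by
    have hsub : ({d | q d = 0} : Finset (Player m ⊕ Fin 2)) ⊆
        (T ∪ if quadricValue x 0 = 0 then {.inl (.inr 0)} else ∅) ∪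
          if quadricValue x 1 = 0 then {.inl (.inr 1)} else ∅ := by
      intro d hd
      have hq := (Finset.mem_filter.1 hd).2
      match d with
      | .inl (.inl i) => simp [T, hq]
      | .inl (.inr 0) =>
        have h : quadricValue x 0 = 0 := hq
        simp [h]
      | .inl (.inr 1) =>
        have h : quadricValue x 1 = 0 := hq
        simp [h]
      | .inr l => simp [T, hq]
    refine (Finset.card_le_card hsub).trans ((Finset.card_union_le _ _).trans ?_)
    refine add_le_add ((Finset.card_union_le _ _).trans (add_le_add hScard.ge ?_)) ?_ <;>
      split_ifs <;> simp
  have hzero := eq_zero_of_cubicValue hS (hcard'.trans hsplit)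
  obtain ⟨c, hc, hcne⟩ := p.relevant_coord none
  rcases c with c | c
  · simp [factor] at hc
  · exact hcne (hzero c)

end NashCI

theorem proposition2p4 (m : ℕ) :
    NashCI.Generic (fun X : NashCI.Game m =>
      NashCI.IsCurve (NashCI.spohnCI X) ∧
      NashCI.IsCompleteIntersection (NashCI.spohnCI X) (NashCI.poly X) NashCI.multidegree) := by
  have h0 := NashCI.isMultihomogeneous_splitForm m 0
  have h1 := NashCI.isMultihomogeneous_splitForm m 1
  obtain ⟨G, hG, h⟩ := NashCI.generic_of_exists (NashCI.splitGame m) h0 h1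
    (NashCI.spohnCI_splitGame_inter m)
  exact ⟨G, hG, fun X hX => NashCI.isCurve_and_isCompleteIntersection X h0 h1 (h X hX)⟩
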